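/- Let $n\in\mathbb N$, let $\mathbb I_1,\dots,\mathbb I_n$ be independent indicator ($\{0,1\}$-valued) random variables with $P(\mathbb I_i=1)=p_i$, and let $W=\sum_{i=1}^n\mathbb I_i$. Put $$\sigma^2=\sum_{i=1}^n p_i(1-p_i),\qquad \tau=\max_{1\le i\le n}p_i(1-p_i),$$ $$M=\Big\lfloor\Big(\sum_{i=1}^n p_i^2\Big)^3\Big(\sum_{i=1}^n p_i^3\Big)^{-2}\Big\rfloor,\qquad \delta=\Big(\sum_{i=1}^n p_i^2\Big)^3\Big(\sum_{i=1}^n p_i^3\Big)^{-2}-M,$$ $$p=\Big(\sum_{i=1}^n p_i^3\Big)\Big(\sum_{i=1}^n p_i^2\Big)^{-1},\qquad q=1-p,\qquad \alpha=\sum_{i=1}^n p_i-Mp,$$ $$\widehat T=\lfloor M+\alpha/p\rfloor,\qquad \theta_2=\frac{\alpha}{q\widehat T}.$$ Let $Y_1$ be Poisson with parameter $\alpha\ge 0$ (identically $0$ if $\alpha=0$), let $Y_2$ be binomial with $M$ trials and success probability $p$, let $Y_1,Y_2$ be independent, and let $\mathrm{BCP}$ denote the law of $Y_1+Y_2$.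 For $\mathbb Z_+$-valued random variables $Y,Z$ write $\|\mathcal L(Y)-\mathcal L(Z)\|_{TV}=\sum_{k=0}^\infty|P(Y=k)-P(Z=k)|$. If $\sigma^2>3\tau$ and $\theta_2<1/2$, then $$\|\mathcal L(W)-\mathrm{BCP}\|_{TV}\le\frac{2}{1-2\theta_2}\left\{\frac{4}{pq\widehat T(\sigma^2-3\tau)}\Big(\sum_{i=1}^n p_i^4-p\sum_{i=1}^n p_i^3\Big)+\delta p^2+P(W>\widehat T)+P(Y_1+Y_2>\widehat T)\right\}.$$ -/

import Mathlib

open MeasureTheory ProbabilityTheory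

namespace BCPApprox

/-- The power sum `∑ i, (p i) ^ k` of the success probabilities. -/
noncomputable def powerSum {n : ℕ} (p : Fin n → ℝ) (k : ℕ) : ℝ := ∑ i, p i ^ k

/-- The real number `(∑ pᵢ²)³ (∑ pᵢ³)⁻²` whose integer part is the number of binomial trials. -/
noncomputable def trialsReal {n : ℕ} (p : Fin n → ℝ) : ℝ :=
  powerSum p 2 ^ 3 * (powerSum p 3 ^ 2)⁻¹

/-- `M`, the integer part of `(∑ pᵢ²)³ (∑ pᵢ³)⁻²`. -/
noncomputable def trials {n : ℕ} (p : Fin n → ℝ) : ℕ := ⌊trialsReal p⌋₊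

/-- `δ`, the fractional part of `(∑ pᵢ²)³ (∑ pᵢ³)⁻²`. -/
noncomputable def delta {n : ℕ} (p : Fin n → ℝ) : ℝ := trialsReal p - trials p

/-- The binomial success probability `(∑ pᵢ³) (∑ pᵢ²)⁻¹` of the approximating law. -/
noncomputable def prob {n : ℕ} (p : Fin n → ℝ) : ℝ := powerSum p 3 * (powerSum p 2)⁻¹

/-- The Poisson parameter `α = ∑ pᵢ - M · prob p` of the approximating law. -/
noncomputable def alpha {n : ℕ} (p : Fin n → ℝ) : ℝ := (∑ i, p i) - trials p * prob p

/-- `T̂`, the integer part of `M + α / prob p`. -/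
noncomputable def That {n : ℕ} (p : Fin n → ℝ) : ℕ := ⌊(trials p : ℝ) + alpha p / prob p⌋₊

/-- `θ₂ = α / ((1 - prob p) T̂)`. -/
noncomputable def theta2 {n : ℕ} (p : Fin n → ℝ) : ℝ := alpha p / ((1 - prob p) * That p)

/-- `σ² = ∑ pᵢ (1 - pᵢ)`. -/
noncomputable def sigmaSq {n : ℕ} (p : Fin n → ℝ) : ℝ := ∑ i, p i * (1 - p i)

/-- `τ = maxᵢ pᵢ (1 - pᵢ)`. -/
noncomputable def tau {n : ℕ} (p : Fin n → ℝ) : ℝ := ⨆ i, p i * (1 - p i)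

theorem prob_mem_Icc {n : ℕ} {p : Fin n → ℝ} (hp : ∀ i, p i ∈ Set.Icc (0 : ℝ) 1) :
    prob p ∈ Set.Icc (0 : ℝ) 1 := by
  have h3 : 0 ≤ powerSum p 3 := Finset.sum_nonneg fun i _ => pow_nonneg (hp i).1 3
  have h2 : 0 ≤ powerSum p 2 := Finset.sum_nonneg fun i _ => pow_nonneg (hp i).1 2
  have h32 : powerSum p 3 ≤ powerSum p 2 :=
    Finset.sum_le_sum fun i _ => pow_le_pow_of_le_one (hp i).1 (hp i).2 (by norm_num)
  refine ⟨mul_nonneg h3 (inv_nonneg.2 h2), ?_⟩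
  rw [prob, ← div_eq_mul_inv]
  exact div_le_one_of_le₀ h32 h2

theorem alpha_nonneg {n : ℕ} {p : Fin n → ℝ} (hp : ∀ i, p i ∈ Set.Icc (0 : ℝ) 1) :
    0 ≤ alpha p := by
  have h1 : 0 ≤ ∑ i, p i := Finset.sum_nonneg fun i _ => (hp i).1
  have h3 : 0 ≤ powerSum p 3 := Finset.sum_nonneg fun i _ => pow_nonneg (hp i).1 3
  have h2 : 0 ≤ powerSum p 2 := Finset.sum_nonneg fun i _ => pow_nonneg (hp i).1 2
  have hcs : powerSum p 2 ^ 2 ≤ (∑ i, p i) * powerSum p 3 := by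
    refine Finset.sum_sq_le_sum_mul_sum_of_sq_le_mul _ (fun i _ => (hp i).1)
      (fun i _ => pow_nonneg (hp i).1 3) (fun i _ => le_of_eq (by ring))
  have hM : (trials p : ℝ) ≤ trialsReal p :=
    Nat.floor_le (mul_nonneg (pow_nonneg h2 3) (inv_nonneg.2 (pow_nonneg h3 2)))
  have hle : (trials p : ℝ) * prob p ≤ trialsReal p * prob p :=
    mul_le_mul_of_nonneg_right hM (prob_mem_Icc hp).1
  suffices h : trialsReal p * prob p ≤ ∑ i, p i by
    rw [alpha]; linarith
  rcases h3.eq_or_lt with h | h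
  · simpa [prob, ← h] using h1
  · rcases h2.eq_or_lt with h' | h'
    · simpa [prob, ← h'] using h1
    · have : trialsReal p * prob p = powerSum p 2 ^ 2 / powerSum p 3 := by
        rw [trialsReal, prob]; field_simp
      rw [this, div_le_iff₀ h]
      exact hcs

/-- The law of `Y₁ + Y₂`, where `Y₁` is Poisson with parameter `α`, `Y₂` is binomial with `M` trials
and success probability `prob p`, and `Y₁`, `Y₂` are independent. When every `pᵢ` lies in `[0, 1]`,
the truncations `Real.toNNReal` and `Set.projIcc` have no effect, by `alpha_nonneg` and
`prob_mem_Icc`. -/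
noncomputable def bcp {n : ℕ} (p : Fin n → ℝ) : Measure ℕ :=
  Measure.conv (poissonMeasure (alpha p).toNNReal)
    (binomial (trials p) (Set.projIcc (0 : ℝ) 1 zero_le_one (prob p)))

/-- The total variation norm `∑ₖ |P(Y = k) - P(Z = k)|` of the difference of two laws on `ℕ`
(twice the total variation distance). -/
noncomputable def tvNorm (μ ν : Measure ℕ) : ℝ := ∑' k : ℕ, |μ.real {k} - ν.real {k}|

end BCPApprox

/-!
The proof is Stein's method, with the law of `Y₁ + Y₂` treated as a perturbation of a binomial law
with the real number `N = (∑ pᵢ) / prob p` of trials.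

*The operator.* The law of `Y₁ + Y₂` is annihilated by the operator `bcpStein`, by the classical
identities for the Poisson and the binomial law (`integral_bcpStein_conv`). This operator is that of
a birth and death chain with birth rates `prob p * (N - j)` and death rates `(1 - prob p) * j`, plus
`α * prob p` times the increment of the argument. Cut off at `T̂ = ⌊N⌋`, the chain has an explicit
stationary law and an explicit solution `pbSol` of its Stein equation. For test functions bounded by
one, the increments of the solution, except the first, are at most `2 / (p q N)` and at most `2`
(`abs_pbSol_diff_le`), where `p = prob p` and `q = 1 - p`. Hence the perturbation is bounded by
`2 θ₂`, and its contribution, at most `2 θ₂` times the total variation norm, is absorbed on the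
left; this is the factor `1 / (1 - 2 θ₂)` (`tvNorm_le_of_stein`). Beyond `T̂` the Stein equation is
not available, and this part is paid for by the two tail probabilities.

*The law of the sum.* Expanding the operator under the law of `W` (`abs_bernExp_bcpStein_le`), the
coefficient of the mean increment is `δ p²`, the mismatch of the variances. What is left is a
covariance, with weights `pᵢ²`, between `pᵢ` and a mean second difference, because `prob p` is the
weighted mean of the `pᵢ`. Written as a sum over pairs, it only involves third differences of the
solution under the law of `W - Xᵢ - Xⱼ`, with total weight `∑ pᵢ⁴ - p ∑ pᵢ³`.

*Smoothness.* A sum of independent indicators has a log-concave, hence unimodal, law, whose maximal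
point probability is at most `1 / √(2 v)` for variance `v` by Fourier inversion; summation by parts
then bounds mean increments by `√(2 / v)`. Removing two indices and splitting the others into two
parts of almost equal variance costs at most `3 τ` of variance in total and gives the factor
`4 / (σ² - 3 τ)` for mean second differences (`abs_bernExp_diff_diff_le`).
-/

namespace BCPApprox

/-! ### Expectations of functions of a sum of independent indicators -/

section BernoulliSum

variable {ι : Type*} [DecidableEq ι] {p : ι → ℝ}

/-- The probability that, among independent indicators with success probabilities `p i`, `i ∈ S`,
exactly those with index in `t` are equal to one. -/
noncomputable def patternProb (p : ι → ℝ) (S t : Finset ι) : ℝ :=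
  (∏ i ∈ t, p i) * ∏ i ∈ S \ t, (1 - p i)

/-- The expectation of `h (∑ i ∈ S, Xᵢ)` for independent indicators `Xᵢ` with success probabilities
`p i`, written as a finite sum over the set `t ⊆ S` of successful indices. -/
noncomputable def bernExp (p : ι → ℝ) (S : Finset ι) (h : ℕ → ℝ) : ℝ :=
  ∑ t ∈ S.powerset, patternProb p S t * h t.card

theorem patternProb_nonneg (hp : ∀ i, p i ∈ Set.Icc (0 : ℝ) 1) (S t : Finset ι) :
    0 ≤ patternProb p S t :=
  mul_nonneg (Finset.prod_nonneg fun i _ => (hp i).1)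
    (Finset.prod_nonneg fun i _ => sub_nonneg.2 (hp i).2)

theorem sum_patternProb (p : ι → ℝ) (S : Finset ι) : ∑ t ∈ S.powerset, patternProb p S t = 1 := by
  have := Finset.prod_add p (fun i => 1 - p i) S
  simpa [patternProb] using this.symm

@[simp]
theorem bernExp_empty (h : ℕ → ℝ) : bernExp p ∅ h = h 0 := by
  simp [bernExp, patternProb]

theorem bernExp_insert {S : Finset ι} {i : ι} (hi : i ∉ S) (h : ℕ → ℝ) :
    bernExp p (insert i S) h =
      (1 - p i) * bernExp p S h + p i * bernExp p S (fun k => h (k + 1)) := by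
  rw [bernExp, Finset.sum_powerset_insert hi, bernExp, bernExp, Finset.mul_sum, Finset.mul_sum]
  refine congrArg₂ (· + ·) (Finset.sum_congr rfl fun t ht => ?_)
    (Finset.sum_congr rfl fun t ht => ?_)
  · have hit : i ∉ t := fun h' => hi (Finset.mem_powerset.1 ht h')
    rw [patternProb, patternProb, Finset.insert_sdiff_of_notMem _ hit,
      Finset.prod_insert (by simp [hi])]
    ring
  · have hit : i ∉ t := fun h' => hi (Finset.mem_powerset.1 ht h')
    rw [patternProb, patternProb, Finset.prod_insert hit, Finset.card_insert_of_notMem hit,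
      Finset.insert_sdiff_insert, Finset.sdiff_insert_of_notMem hi]
    ring

theorem bernExp_add (S : Finset ι) (h₁ h₂ : ℕ → ℝ) :
    bernExp p S (fun k => h₁ k + h₂ k) = bernExp p S h₁ + bernExp p S h₂ := by
  simp [bernExp, mul_add, Finset.sum_add_distrib]

theorem bernExp_sub (S : Finset ι) (h₁ h₂ : ℕ → ℝ) :
    bernExp p S (fun k => h₁ k - h₂ k) = bernExp p S h₁ - bernExp p S h₂ := by
  simp [bernExp, mul_sub, Finset.sum_sub_distrib]

theorem bernExp_const_mul (S : Finset ι) (c : ℝ) (h : ℕ → ℝ) :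
    bernExp p S (fun k => c * h k) = c * bernExp p S h := by
  simp only [bernExp, Finset.mul_sum]
  exact Finset.sum_congr rfl fun t _ => by ring

theorem abs_bernExp_le (hp : ∀ i, p i ∈ Set.Icc (0 : ℝ) 1) (S : Finset ι) {h : ℕ → ℝ} {B : ℝ}
    (hB : ∀ k, |h k| ≤ B) : |bernExp p S h| ≤ B := by
  calc |bernExp p S h| ≤ ∑ t ∈ S.powerset, |patternProb p S t * h t.card| :=
        Finset.abs_sum_le_sum_abs _ _
    _ ≤ ∑ t ∈ S.powerset, patternProb p S t * B := by
        refine Finset.sum_le_sum fun t _ => ?_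
        rw [abs_mul, abs_of_nonneg (patternProb_nonneg hp S t)]
        exact mul_le_mul_of_nonneg_left (hB _) (patternProb_nonneg hp S t)
    _ = B := by rw [← Finset.sum_mul, sum_patternProb, one_mul]

/-- Conditioning on a single indicator, in terms of the forward difference of `h`. -/
theorem bernExp_eq_erase {S : Finset ι} {i : ι} (hi : i ∈ S) (h : ℕ → ℝ) :
    bernExp p S h = bernExp p (S.erase i) h
      + p i * bernExp p (S.erase i) (fun k => h (k + 1) - h k) := by
  conv_lhs => rw [← Finset.insert_erase hi]
  rw [bernExp_insert (Finset.notMem_erase i S), bernExp_sub]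
  ring

/-- The sum over `S ∪ S'` is the sum of two independent parts. -/
theorem bernExp_union {S S' : Finset ι} (hd : Disjoint S S') (h : ℕ → ℝ) :
    bernExp p (S ∪ S') h = bernExp p S (fun k => bernExp p S' (fun l => h (k + l))) := by
  induction S using Finset.induction_on generalizing h with
  | empty => simp
  | insert i S hi ih =>
    rw [Finset.disjoint_insert_left] at hd
    rw [Finset.insert_union, bernExp_insert (by simp [hi, hd.1]), bernExp_insert hi, ih hd.2,
      ih hd.2]
    simp only [add_right_comm]

/-- The size-bias identity `E[W h(W)] = ∑ pᵢ E h(W - Xᵢ + 1)`. -/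
theorem bernExp_natCast_mul (S : Finset ι) (h : ℕ → ℝ) :
    bernExp p S (fun k => (k : ℝ) * h k)
      = ∑ i ∈ S, p i * bernExp p (S.erase i) (fun k => h (k + 1)) := by
  induction S using Finset.induction_on generalizing h with
  | empty => simp
  | insert a S ha ih =>
    have hsplit : (fun k : ℕ => ((k + 1 : ℕ) : ℝ) * h (k + 1))
        = fun k : ℕ => (k : ℝ) * h (k + 1) + h (k + 1) := by
      funext k; push_cast; ring
    rw [bernExp_insert ha, hsplit, bernExp_add, ih, ih (fun k => h (k + 1)),
      Finset.sum_insert ha, Finset.erase_insert ha]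
    have hS : ∀ i ∈ S, bernExp p ((insert a S).erase i) (fun k => h (k + 1))
        = (1 - p a) * bernExp p (S.erase i) (fun k => h (k + 1))
          + p a * bernExp p (S.erase i) (fun k => h (k + 1 + 1)) := by
      intro i hi
      have hai : a ≠ i := fun h' => ha (h' ▸ hi)
      rw [Finset.erase_insert_of_ne hai, bernExp_insert (by simp [ha])]
    have hsum : ∑ i ∈ S, p i * bernExp p ((insert a S).erase i) (fun k => h (k + 1))
        = (1 - p a) * ∑ i ∈ S, p i * bernExp p (S.erase i) (fun k => h (k + 1))
          + p a * ∑ i ∈ S, p i * bernExp p (S.erase i) (fun k => h (k + 1 + 1)) := by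
      rw [Finset.mul_sum, Finset.mul_sum, ← Finset.sum_add_distrib]
      exact Finset.sum_congr rfl fun i hi => by rw [hS i hi]; ring
    rw [hsum]
    ring

end BernoulliSum

/-- Integrating a function of a sum of independent indicators. -/
theorem integral_sum_indicators {Ω ι : Type*} [DecidableEq ι] [MeasurableSpace Ω] (μ : Measure Ω)
    [IsProbabilityMeasure μ] {X : ι → Ω → ℕ} (hX : ∀ i, Measurable (X i))
    (hX01 : ∀ i ω, X i ω = 0 ∨ X i ω = 1) (hind : iIndepFun X μ) {p : ι → ℝ}
    (hp : ∀ i, p i = μ.real {ω | X i ω = 1}) (S : Finset ι) (h : ℕ → ℝ) :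
    ∫ ω, h (∑ i ∈ S, X i ω) ∂μ = bernExp p S h := by
  induction S using Finset.induction_on generalizing h with
  | empty => simp
  | insert a S ha ih =>
    have hbd : ∀ ω, ∑ i ∈ S, X i ω ≤ S.card := fun ω => by
      simpa using Finset.sum_le_card_nsmul S (fun i => X i ω) 1
        (fun i _ => by rcases hX01 i ω with h | h <;> simp [h])
    have hSm : Measurable fun ω => ∑ i ∈ S, X i ω := Finset.measurable_sum _ fun i _ => hX i
    have hint : ∀ f : ℕ → ℝ, Integrable (fun ω => f (∑ i ∈ S, X i ω)) μ := fun f =>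
      Integrable.of_bound ((measurable_of_countable f).comp hSm).aestronglyMeasurable
        (∑ k ∈ Finset.range (S.card + 1), |f k|) (Filter.Eventually.of_forall fun ω =>
          Finset.single_le_sum (f := fun k => |f k|) (fun k _ => abs_nonneg _)
            (Finset.mem_range.2 (Nat.lt_succ_of_le (hbd ω))))
    have hXint : Integrable (fun ω => (X a ω : ℝ)) μ :=
      Integrable.of_bound ((measurable_of_countable (fun k : ℕ => (k : ℝ))).comp
        (hX a)).aestronglyMeasurable 1 (Filter.Eventually.of_forall fun ω => by
          rcases hX01 a ω with h | h <;> simp [h])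
    have hEX : ∫ ω, (X a ω : ℝ) ∂μ = p a := by
      have hm : MeasurableSet {ω | X a ω = 1} := (hX a) (measurableSet_singleton 1)
      rw [hp a, ← integral_indicator_one hm]
      refine integral_congr_ae (Filter.Eventually.of_forall fun ω => ?_)
      rcases hX01 a ω with h | h <;> simp [Set.indicator, h]
    have hindS : IndepFun (fun ω => ∑ i ∈ S, X i ω) (X a) μ := by
      have := hind.indepFun_finsetSum_of_notMem hX ha
      convert this using 1
      funext ω; simp
    have hprod : ∀ f : ℕ → ℝ, ∫ ω, f (∑ i ∈ S, X i ω) * (X a ω : ℝ) ∂μ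
        = (∫ ω, f (∑ i ∈ S, X i ω) ∂μ) * p a := by
      intro f
      rw [← hEX]
      exact (hindS.comp (measurable_of_countable f)
        (measurable_of_countable (fun k : ℕ => (k : ℝ)))).integral_fun_mul_eq_mul_integral
        (hint f).aestronglyMeasurable hXint.aestronglyMeasurable
    have hprodint : ∀ f : ℕ → ℝ, Integrable (fun ω => f (∑ i ∈ S, X i ω) * (X a ω : ℝ)) μ :=
      fun f => (hindS.comp (measurable_of_countable f)
        (measurable_of_countable (fun k : ℕ => (k : ℝ)))).integrable_mul (hint f) hXint
    have hpt : ∀ ω, h (∑ i ∈ insert a S, X i ω) = h (∑ i ∈ S, X i ω)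
        + (h (∑ i ∈ S, X i ω + 1) - h (∑ i ∈ S, X i ω)) * (X a ω : ℝ) := by
      intro ω
      rw [Finset.sum_insert ha]
      rcases hX01 a ω with h | h <;> simp [h, add_comm]
    rw [integral_congr_ae (Filter.Eventually.of_forall hpt),
      integral_add (hint h) (hprodint fun k => h (k + 1) - h k),
      hprod fun k => h (k + 1) - h k, ih, ih (fun k => h (k + 1) - h k), bernExp_insert ha,
      bernExp_sub]
    ring

/-! ### Smoothness of sums of independent indicators -/

section Smoothness

variable {ι : Type*} [DecidableEq ι] {p : ι → ℝ}

/-- The probability that `∑ i ∈ S, Xᵢ = k`. Letting `k` range over `ℤ` makes the recursion in `S`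
uniform in `k`. -/
noncomputable def bernPoint (p : ι → ℝ) (S : Finset ι) (k : ℤ) : ℝ :=
  bernExp p S fun j => if (j : ℤ) = k then 1 else 0

theorem bernPoint_nonneg (hp : ∀ i, p i ∈ Set.Icc (0 : ℝ) 1) (S : Finset ι) (k : ℤ) :
    0 ≤ bernPoint p S k :=
  Finset.sum_nonneg fun t _ => mul_nonneg (patternProb_nonneg hp S t)
    (by dsimp only; split_ifs <;> norm_num)

theorem bernPoint_insert {S : Finset ι} {i : ι} (hi : i ∉ S) (k : ℤ) :
    bernPoint p (insert i S) k = (1 - p i) * bernPoint p S k + p i * bernPoint p S (k - 1) := by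
  rw [bernPoint, bernExp_insert hi, bernPoint, bernPoint]
  congr 3
  funext j
  exact if_congr (by push_cast; omega) rfl rfl

/-- The law of a sum of independent indicators is log-concave, in the strong form (a Pólya frequency
sequence of order two) which is preserved by adding one more indicator. -/
theorem bernPoint_mul_le (hp : ∀ i, p i ∈ Set.Icc (0 : ℝ) 1) (S : Finset ι) {i j : ℤ}
    (hij : i ≤ j) :
    bernPoint p S (i - 1) * bernPoint p S (j + 1) ≤ bernPoint p S i * bernPoint p S j := by
  induction S using Finset.induction_on generalizing i j with
  | empty =>
    have h : bernPoint p ∅ (i - 1) * bernPoint p ∅ (j + 1) = 0 := by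
      simp only [bernPoint, bernExp_empty, Nat.cast_zero]
      by_cases h1 : (0 : ℤ) = i - 1
      · rw [if_neg (by omega : ¬ (0 : ℤ) = j + 1), mul_zero]
      · rw [if_neg h1, zero_mul]
    rw [h]
    exact mul_nonneg (bernPoint_nonneg hp _ _) (bernPoint_nonneg hp _ _)
  | insert a S ha ih =>
    rw [bernPoint_insert ha, bernPoint_insert ha, bernPoint_insert ha, bernPoint_insert ha]
    obtain ⟨h0, h1⟩ := hp a
    have e1 := ih hij
    have e2 := ih (show i - 1 ≤ j - 1 by omega)
    have e3 : bernPoint p S (i - 1 - 1) * bernPoint p S (j + 1)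
        ≤ bernPoint p S i * bernPoint p S (j - 1) := by
      rcases hij.eq_or_lt with h | h
      · subst h
        rw [mul_comm (bernPoint p S i)]
        exact ih (by omega)
      · have e4 := ih (show i - 1 ≤ j by omega)
        have e5 := ih (show i ≤ j - 1 by omega)
        rw [sub_add_cancel] at e5
        exact e4.trans e5
    rw [sub_add_cancel] at e2
    rw [add_sub_cancel_right]
    nlinarith [mul_le_mul_of_nonneg_left e1 (mul_nonneg (sub_nonneg.2 h1) (sub_nonneg.2 h1)),
      mul_le_mul_of_nonneg_left e2 (mul_nonneg h0 h0),
      mul_le_mul_of_nonneg_left e3 (mul_nonneg h0 (sub_nonneg.2 h1))]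

theorem bernPoint_eq_zero_of_card_lt {S : Finset ι} {k : ℕ} (hk : S.card < k) :
    bernPoint p S k = 0 := by
  refine Finset.sum_eq_zero fun t ht => ?_
  have := Finset.card_le_card (Finset.mem_powerset.1 ht)
  dsimp only
  rw [if_neg (by omega), mul_zero]

theorem bernExp_eq_sum_bernPoint (S : Finset ι) (h : ℕ → ℝ) {n : ℕ} (hn : S.card < n) :
    bernExp p S h = ∑ k ∈ Finset.range n, bernPoint p S k * h k := by
  simp only [bernPoint, bernExp, Finset.sum_mul]
  rw [Finset.sum_comm]
  refine Finset.sum_congr rfl fun t ht => ?_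
  have := Finset.card_le_card (Finset.mem_powerset.1 ht)
  rw [Finset.sum_eq_single t.card]
  · simp
  · intro k _ hk
    rw [if_neg (by omega)]; ring
  · intro h; exact absurd (Finset.mem_range.2 (by omega)) h

/-- The law of a sum of independent indicators is unimodal. -/
theorem exists_mode (hp : ∀ i, p i ∈ Set.Icc (0 : ℝ) 1) (S : Finset ι) :
    ∃ m : ℕ, m ≤ S.card ∧ (∀ k < m, bernPoint p S k ≤ bernPoint p S (k + 1 : ℕ)) ∧
      ∀ k, m ≤ k → bernPoint p S (k + 1 : ℕ) ≤ bernPoint p S k := by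
  obtain ⟨m, hm, hmax⟩ := Finset.exists_max_image (Finset.range (S.card + 1))
    (fun k : ℕ => bernPoint p S k) ⟨0, by simp⟩
  have hm' : m ≤ S.card := Nat.lt_succ_iff.1 (Finset.mem_range.1 hm)
  have hle : ∀ k : ℕ, bernPoint p S k ≤ bernPoint p S m := by
    intro k
    by_cases hk : S.card < k
    · rw [bernPoint_eq_zero_of_card_lt hk]; exact bernPoint_nonneg hp S m
    · exact hmax k (Finset.mem_range.2 (by omega))
  have hpos : 0 < bernPoint p S m := by
    refine (bernPoint_nonneg hp S m).lt_of_ne fun h0 => ?_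
    have h1 : bernExp p S (fun _ => 1) = 1 := by simp [bernExp, sum_patternProb]
    rw [bernExp_eq_sum_bernPoint S _ (Nat.lt_succ_self _), Finset.sum_eq_zero] at h1
    · exact zero_ne_one h1
    · intro k _
      rw [le_antisymm ((hle k).trans h0.symm.le) (bernPoint_nonneg hp S k), zero_mul]
  refine ⟨m, hm', fun k hk => ?_, fun k hk => ?_⟩
  · rcases (Nat.succ_le_of_lt hk).eq_or_lt with h | hlt
    · subst h; exact hle _
    · have h := bernPoint_mul_le hp S (show ((k : ℤ) + 1) ≤ m - 1 by omega)
      rw [add_sub_cancel_right, sub_add_cancel] at h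
      have h2 : bernPoint p S ((m : ℤ) - 1) ≤ bernPoint p S m := by
        have := hle (m - 1)
        rwa [Nat.cast_sub (by omega), Nat.cast_one] at this
      rw [Nat.cast_add, Nat.cast_one]
      exact le_of_mul_le_mul_right
        (h.trans (mul_le_mul_of_nonneg_left h2 (bernPoint_nonneg hp S _))) hpos
  · rcases hk.eq_or_lt with h | h
    · rw [← h]; exact hle _
    · have h := bernPoint_mul_le hp S (show ((m : ℤ) + 1) ≤ k by omega)
      rw [add_sub_cancel_right] at h
      have h2 := hle (m + 1)
      rw [Nat.cast_add, Nat.cast_one] at h2 ⊢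
      refine le_of_mul_le_mul_left (h.trans ?_) hpos
      exact mul_le_mul_of_nonneg_right h2 (bernPoint_nonneg hp S _)

/-- A sequence that increases up to `m` and decreases afterwards has total variation governed by its
maximal value. -/
theorem sum_abs_sub_of_unimodal {b : ℕ → ℝ} {m : ℕ} (hup : ∀ k < m, b k ≤ b (k + 1))
    (hdown : ∀ k, m ≤ k → b (k + 1) ≤ b k) (d : ℕ) :
    ∑ k ∈ Finset.range (m + d), |b (k + 1) - b k| = 2 * b m - b 0 - b (m + d) := by
  induction d with
  | zero =>
    rw [add_zero, Finset.sum_congr rfl fun k hk =>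
      abs_of_nonneg (sub_nonneg.2 (hup k (Finset.mem_range.1 hk))), Finset.sum_range_sub]
    ring
  | succ d ih =>
    rw [← add_assoc, Finset.sum_range_succ, ih,
      abs_of_nonpos (sub_nonpos.2 (hdown (m + d) (Nat.le_add_right _ _)))]
    ring

theorem norm_bernoulli_char_le {a : ℝ} (ha : a ∈ Set.Icc (0 : ℝ) 1) {x : ℝ} (hx : |x| ≤ Real.pi) :
    ‖(a : ℂ) * Complex.exp (x * Complex.I) + (1 - a)‖
      ≤ Real.exp (-(2 * (a * (1 - a)) / Real.pi ^ 2) * x ^ 2) := by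
  have h0 : 0 ≤ a * (1 - a) := mul_nonneg ha.1 (sub_nonneg.2 ha.2)
  have hsq : ‖(a : ℂ) * Complex.exp (x * Complex.I) + (1 - a)‖ ^ 2
      = 1 - 2 * (a * (1 - a)) * (1 - Real.cos x) := by
    rw [Complex.sq_norm, Complex.normSq_apply]
    simp only [Complex.add_re, Complex.add_im, Complex.mul_re, Complex.mul_im, Complex.ofReal_re,
      Complex.ofReal_im, Complex.exp_ofReal_mul_I_re, Complex.exp_ofReal_mul_I_im, Complex.sub_re,
      Complex.sub_im, Complex.one_re, Complex.one_im]
    have := Real.sin_sq_add_cos_sq x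
    linear_combination a ^ 2 * this
  have hcos := Real.cos_le_one_sub_mul_cos_sq hx
  refine le_of_sq_le_sq ?_ (Real.exp_pos _).le
  rw [hsq, ← Real.exp_nat_mul]
  refine le_trans ?_ (Real.add_one_le_exp _)
  have := mul_le_mul_of_nonneg_left hcos h0
  have e : ((2 : ℕ) : ℝ) * (-(2 * (a * (1 - a)) / Real.pi ^ 2) * x ^ 2)
      = - 2 * (a * (1 - a) * (2 / Real.pi ^ 2 * x ^ 2)) := by push_cast; ring
  rw [e]
  nlinarith

theorem integral_exp_int_mul_I (l : ℤ) :
    ∫ x in (-Real.pi)..Real.pi, Complex.exp ((l * Complex.I) * x)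
      = if l = 0 then (2 * Real.pi : ℂ) else 0 := by
  split_ifs with h
  · subst h
    simp
    ring
  · have hc : (l * Complex.I : ℂ) ≠ 0 := by simp [h]
    rw [integral_exp_mul_complex hc, div_eq_zero_iff, sub_eq_zero]
    left
    rw [Complex.exp_eq_exp_iff_exists_int]
    exact ⟨l, by push_cast; ring⟩

/-- Fourier inversion bounds the point probabilities of a sum of independent indicators by the
inverse of its standard deviation. -/
theorem bernPoint_le (hp : ∀ i, p i ∈ Set.Icc (0 : ℝ) 1) (S : Finset ι)
    (hv : 0 < ∑ i ∈ S, p i * (1 - p i)) (m : ℤ) :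
    bernPoint p S m ≤ √(1 / (2 * ∑ i ∈ S, p i * (1 - p i))) := by
  set v := ∑ i ∈ S, p i * (1 - p i) with hvdef
  set c := 2 * v / Real.pi ^ 2 with hcdef
  have hpi := Real.pi_pos
  have hc : 0 < c := by positivity
  have hchar : ∀ x : ℝ, ∑ t ∈ S.powerset, (patternProb p S t : ℂ)
        * Complex.exp ((((t.card : ℤ) - m : ℤ) * Complex.I) * x)
      = (∏ i ∈ S, ((p i : ℂ) * Complex.exp (x * Complex.I) + (1 - p i)))
        * Complex.exp (-(m * x : ℝ) * Complex.I) := by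
    intro x
    rw [Finset.prod_add, Finset.sum_mul]
    refine Finset.sum_congr rfl fun t _ => ?_
    rw [Finset.prod_mul_distrib, Finset.prod_const, ← Complex.exp_nat_mul, patternProb]
    push_cast
    rw [show (((t.card : ℂ) - m) * Complex.I) * x
      = t.card * (x * Complex.I) + -(m * x) * Complex.I by ring, Complex.exp_add]
    ring
  have hint : ∫ x in (-Real.pi)..Real.pi, ∑ t ∈ S.powerset, (patternProb p S t : ℂ)
        * Complex.exp ((((t.card : ℤ) - m : ℤ) * Complex.I) * x)
      = ((2 * Real.pi * bernPoint p S m : ℝ) : ℂ) := by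
    rw [intervalIntegral.integral_finsetSum fun t _ =>
      Continuous.intervalIntegrable (by fun_prop) _ _]
    simp only [intervalIntegral.integral_const_mul, integral_exp_int_mul_I]
    rw [bernPoint, bernExp]
    push_cast
    rw [Finset.mul_sum]
    refine Finset.sum_congr rfl fun t _ => ?_
    simp only [sub_eq_zero]
    split_ifs <;> simp
    ring
  have hnorm : ∀ x ∈ Set.Ioc (-Real.pi) Real.pi, ‖∑ t ∈ S.powerset, (patternProb p S t : ℂ)
        * Complex.exp ((((t.card : ℤ) - m : ℤ) * Complex.I) * x)‖ ≤ Real.exp (-c * x ^ 2) := by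
    intro x hx
    have hx' : |x| ≤ Real.pi := abs_le.2 ⟨hx.1.le, hx.2⟩
    rw [hchar, norm_mul, ← Complex.ofReal_neg, Complex.norm_exp_ofReal_mul_I, mul_one, norm_prod]
    refine (Finset.prod_le_prod (fun i _ => norm_nonneg _)
      fun i _ => norm_bernoulli_char_le (hp i) hx').trans (le_of_eq ?_)
    rw [← Real.exp_sum, ← Finset.sum_mul, hcdef, hvdef, Finset.mul_sum, Finset.sum_div,
      Finset.sum_neg_distrib]
  have hgauss : 2 * Real.pi * bernPoint p S m ≤ √(Real.pi / c) := by
    calc 2 * Real.pi * bernPoint p S m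
        = ‖((2 * Real.pi * bernPoint p S m : ℝ) : ℂ)‖ := by
          rw [Complex.norm_real, Real.norm_of_nonneg]
          exact mul_nonneg (by positivity) (bernPoint_nonneg hp S m)
      _ ≤ ∫ x in (-Real.pi)..Real.pi, Real.exp (-c * x ^ 2) := by
          rw [← hint]
          exact intervalIntegral.norm_integral_le_of_norm_le (by linarith)
            (Filter.Eventually.of_forall hnorm)
            (Continuous.intervalIntegrable (by fun_prop) _ _)
      _ ≤ ∫ x : ℝ, Real.exp (-c * x ^ 2) := by
          rw [intervalIntegral.integral_of_le (by linarith)]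
          exact setIntegral_le_integral (integrable_exp_neg_mul_sq hc)
            (Filter.Eventually.of_forall fun x => (Real.exp_pos _).le)
      _ = √(Real.pi / c) := integral_gaussian c
  -- The Gaussian bound is `√(π / (8 v))`, and `π ≤ 4`.
  have hle : √(Real.pi / c) ≤ 2 * Real.pi * √(1 / (2 * v)) := by
    rw [show (2 * Real.pi) * √(1 / (2 * v)) = √((2 * Real.pi) ^ 2 * (1 / (2 * v))) by
      rw [Real.sqrt_mul (by positivity), Real.sqrt_sq (by positivity)]]
    refine Real.sqrt_le_sqrt ?_
    rw [hcdef, show Real.pi / (2 * v / Real.pi ^ 2) = Real.pi * (Real.pi ^ 2 / (2 * v)) by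
      field_simp, show (2 * Real.pi) ^ 2 * (1 / (2 * v)) = 4 * (Real.pi ^ 2 / (2 * v)) by ring]
    exact mul_le_mul_of_nonneg_right Real.pi_le_four (by positivity)
  exact le_of_mul_le_mul_left (hgauss.trans hle) (by positivity)

/-- Summation by parts against a unimodal law: the mean increment of a function bounded by `B` is at
most `2B` times the maximal point probability. -/
theorem abs_bernExp_diff_le (hp : ∀ i, p i ∈ Set.Icc (0 : ℝ) 1) (S : Finset ι)
    (hv : 0 < ∑ i ∈ S, p i * (1 - p i)) {h : ℕ → ℝ} {B : ℝ} (hB : ∀ k, |h k| ≤ B) :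
    |bernExp p S (fun k => h (k + 1) - h k)| ≤ √(2 / ∑ i ∈ S, p i * (1 - p i)) * B := by
  obtain ⟨m, hm, hup, hdown⟩ := exists_mode hp S
  set b : ℕ → ℝ := fun k => bernPoint p S k with hb
  have hb0 : ∀ k, 0 ≤ b k := fun k => bernPoint_nonneg hp S k
  have hB0 : 0 ≤ B := (abs_nonneg _).trans (hB 0)
  have hparts : ∀ n, ∑ k ∈ Finset.range n, b k * (h (k + 1) - h k)
      = b n * h n - b 0 * h 0 - ∑ k ∈ Finset.range n, (b (k + 1) - b k) * h (k + 1) := by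
    intro n
    induction n with
    | zero => simp
    | succ n ih => rw [Finset.sum_range_succ, Finset.sum_range_succ, ih]; ring
  obtain ⟨d, hd⟩ := Nat.exists_eq_add_of_le (hm.trans (Nat.le_succ S.card))
  have hlast : b (m + d) = 0 := bernPoint_eq_zero_of_card_lt (by omega)
  have hmain : |bernExp p S (fun k => h (k + 1) - h k)| ≤ 2 * b m * B := by
    rw [bernExp_eq_sum_bernPoint S _ (show S.card < m + d by omega), hparts, hlast, zero_mul,
      zero_sub]
    have h1 : |∑ k ∈ Finset.range (m + d), (b (k + 1) - b k) * h (k + 1)|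
        ≤ (2 * b m - b 0) * B := by
      refine (Finset.abs_sum_le_sum_abs _ _).trans ?_
      rw [show 2 * b m - b 0 = ∑ k ∈ Finset.range (m + d), |b (k + 1) - b k| by
        rw [sum_abs_sub_of_unimodal (b := b) hup hdown, hlast, sub_zero], Finset.sum_mul]
      refine Finset.sum_le_sum fun k _ => ?_
      rw [abs_mul]
      exact mul_le_mul_of_nonneg_left (hB _) (abs_nonneg _)
    have h2 : |-(b 0 * h 0)| ≤ b 0 * B := by
      rw [abs_neg, abs_mul, abs_of_nonneg (hb0 0)]
      exact mul_le_mul_of_nonneg_left (hB 0) (hb0 0)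
    refine (abs_sub _ _).trans ?_
    linarith
  refine hmain.trans (mul_le_mul_of_nonneg_right ?_ hB0)
  calc 2 * b m ≤ 2 * √(1 / (2 * ∑ i ∈ S, p i * (1 - p i))) :=
        mul_le_mul_of_nonneg_left (bernPoint_le hp S hv m) zero_le_two
    _ = √(2 / ∑ i ∈ S, p i * (1 - p i)) := by
        rw [show (2 : ℝ) / ∑ i ∈ S, p i * (1 - p i)
          = 2 ^ 2 * (1 / (2 * ∑ i ∈ S, p i * (1 - p i))) by field_simp,
          Real.sqrt_mul (by positivity), Real.sqrt_sq zero_le_two]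

/-- A finite family of weights in `[0, c]` can be split into two parts whose sums differ by at most
`c`. -/
theorem exists_balanced_subset {v : ι → ℝ} {c : ℝ} (hc : 0 ≤ c) (hv0 : ∀ i, 0 ≤ v i)
    (hvc : ∀ i, v i ≤ c) (S : Finset ι) :
    ∃ A ⊆ S, |∑ i ∈ A, v i - ∑ i ∈ S \ A, v i| ≤ c := by
  induction S using Finset.induction_on with
  | empty => exact ⟨∅, subset_rfl, by simpa using hc⟩
  | insert a S ha ih =>
    obtain ⟨A, hAS, hA⟩ := ih
    have haA : a ∉ A := fun h => ha (hAS h)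
    rw [abs_le] at hA
    have h0 := hv0 a
    have hc' := hvc a
    rcases le_total (∑ i ∈ A, v i) (∑ i ∈ S \ A, v i) with h | h
    · refine ⟨insert a A, Finset.insert_subset_insert _ hAS, ?_⟩
      rw [Finset.sum_insert haA, Finset.insert_sdiff_insert, Finset.sdiff_insert_of_notMem ha,
        abs_le]
      constructor <;> linarith [hA.1, hA.2]
    · refine ⟨A, hAS.trans (Finset.subset_insert _ _), ?_⟩
      rw [Finset.insert_sdiff_of_notMem _ haA, Finset.sum_insert (by simp [ha]), abs_le]
      constructor <;> linarith [hA.1, hA.2]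

/-- The mean second difference, obtained by splitting the sum into two independent parts of almost
equal variance and differencing each of them once. -/
theorem abs_bernExp_diff_diff_le (hp : ∀ i, p i ∈ Set.Icc (0 : ℝ) 1) {c : ℝ} (hc : 0 ≤ c)
    (hpc : ∀ i, p i * (1 - p i) ≤ c) (S : Finset ι) {V : ℝ} (hV : 0 < V)
    (hVS : V + c ≤ ∑ i ∈ S, p i * (1 - p i)) {h : ℕ → ℝ} {B : ℝ} (hB : ∀ k, |h k| ≤ B) :
    |bernExp p S (fun k => (h (k + 2) - h (k + 1)) - (h (k + 1) - h k))| ≤ 4 / V * B := by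
  obtain ⟨A, hAS, hA⟩ := exists_balanced_subset hc
    (fun i => mul_nonneg (hp i).1 (sub_nonneg.2 (hp i).2)) hpc S
  have hB0 : 0 ≤ B := (abs_nonneg _).trans (hB 0)
  have hsum := Finset.sum_sdiff hAS (f := fun i => p i * (1 - p i))
  rw [abs_le] at hA
  have hsmooth : ∀ D : Finset ι, V / 2 ≤ ∑ i ∈ D, p i * (1 - p i) → ∀ (f : ℕ → ℝ) (C : ℝ),
      (∀ k, |f k| ≤ C) → |bernExp p D (fun k => f (k + 1) - f k)| ≤ √(4 / V) * C := by
    intro D hD f C hf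
    refine (abs_bernExp_diff_le hp D (by linarith) hf).trans
      (mul_le_mul_of_nonneg_right (Real.sqrt_le_sqrt ?_) ((abs_nonneg _).trans (hf 0)))
    rw [div_le_div_iff₀ (by linarith) hV]
    linarith
  have h1 := hsmooth A (by linarith [hA.1])
    (fun k => bernExp p (S \ A) (fun l => h (k + l + 1) - h (k + l))) (√(4 / V) * B) (fun k => by
      have := hsmooth (S \ A) (by linarith [hA.2]) (fun l => h (k + l)) B (fun l => hB _)
      simpa only [add_assoc] using this)
  have hE : bernExp p S (fun k => (h (k + 2) - h (k + 1)) - (h (k + 1) - h k))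
      = bernExp p A (fun k => bernExp p (S \ A) (fun l => h (k + 1 + l + 1) - h (k + 1 + l))
          - bernExp p (S \ A) (fun l => h (k + l + 1) - h (k + l))) := by
    conv_lhs => rw [← Finset.union_sdiff_of_subset hAS, bernExp_union Finset.disjoint_sdiff]
    congr 1
    funext k
    rw [← bernExp_sub]
    congr 1
    funext l
    rw [show k + 1 + l + 1 = k + l + 2 by omega, show k + 1 + l = k + l + 1 by omega]
  rw [hE]
  refine h1.trans (le_of_eq ?_)
  rw [← mul_assoc, Real.mul_self_sqrt (by positivity)]

end Smoothness

/-! ### The Stein equation of a truncated pseudo-binomial law -/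

section PseudoBinomial

/-- The unnormalised pseudo-binomial weights `C(N, j) (p / q) ^ j` with a real number `N` of trials,
defined through the ratio of consecutive weights. They are the stationary weights of the birth and
death chain with birth rates `p (N - j)` and death rates `q j`. -/
noncomputable def pbWeight (p q N : ℝ) : ℕ → ℝ
  | 0 => 1
  | j + 1 => pbWeight p q N j * (p * (N - j)) / (q * (j + 1))

/-- The mass of `{0, …, j - 1}` relative to the weight of `j`. -/
noncomputable def pbLower (p q N : ℝ) (j : ℕ) : ℝ :=
  (∑ i ∈ Finset.range j, pbWeight p q N i) / pbWeight p q N j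

/-- The mass of `{j + 1, …, T}` relative to the weight of `j`. -/
noncomputable def pbUpper (p q N : ℝ) (T j : ℕ) : ℝ :=
  (∑ i ∈ Finset.Ico (j + 1) (T + 1), pbWeight p q N i) / pbWeight p q N j

/-- The mean of `f` under the pseudo-binomial law truncated to `{0, …, T}`. -/
noncomputable def pbMean (p q N : ℝ) (T : ℕ) (f : ℕ → ℝ) : ℝ :=
  (∑ i ∈ Finset.range (T + 1), pbWeight p q N i * f i) /
    ∑ i ∈ Finset.range (T + 1), pbWeight p q N i

/-- The solution of the Stein equation of the truncated pseudo-binomial law, extended by zero beyond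
`T`. Its value at `0`, where the quotient is `0 / 0`, plays no role. -/
noncomputable def pbSol (p q N : ℝ) (T : ℕ) (f : ℕ → ℝ) (j : ℕ) : ℝ :=
  if j ≤ T then
    (∑ i ∈ Finset.range j, pbWeight p q N i * (f i - pbMean p q N T f)) /
      (q * j * pbWeight p q N j)
  else 0

variable {p q N : ℝ} {T : ℕ}

theorem pbWeight_pos (hp : 0 < p) (hq : 0 < q) (hN : (T : ℝ) ≤ N) {j : ℕ} (hj : j ≤ T) :
    0 < pbWeight p q N j := by
  induction j with
  | zero => exact one_pos
  | succ j ih =>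
    have hjT : (j : ℝ) + 1 ≤ T := by exact_mod_cast hj
    have : 0 < N - j := by linarith
    have := ih (by omega)
    rw [pbWeight]
    positivity

/-- Detailed balance for the birth and death chain. -/
theorem pbWeight_succ (hq : 0 < q) (j : ℕ) :
    q * (j + 1) * pbWeight p q N (j + 1) = p * (N - j) * pbWeight p q N j := by
  rw [pbWeight]
  field_simp

theorem pbLower_nonneg (hp : 0 < p) (hq : 0 < q) (hN : (T : ℝ) ≤ N) {j : ℕ} (hj : j ≤ T) :
    0 ≤ pbLower p q N j :=
  div_nonneg (Finset.sum_nonneg fun _ hi =>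
    (pbWeight_pos hp hq hN ((Finset.mem_range.1 hi).le.trans hj)).le) (pbWeight_pos hp hq hN hj).le

theorem pbUpper_nonneg (hp : 0 < p) (hq : 0 < q) (hN : (T : ℝ) ≤ N) {j : ℕ} (hj : j ≤ T) :
    0 ≤ pbUpper p q N T j :=
  div_nonneg (Finset.sum_nonneg fun _ hi =>
    (pbWeight_pos hp hq hN (Nat.lt_succ_iff.1 (Finset.mem_Ico.1 hi).2)).le)
    (pbWeight_pos hp hq hN hj).le

@[simp]
theorem pbLower_zero : pbLower p q N 0 = 0 := by simp [pbLower]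

@[simp]
theorem pbUpper_self : pbUpper p q N T T = 0 := by simp [pbUpper]

theorem pbLower_succ (hp : 0 < p) (hq : 0 < q) (hN : (T : ℝ) ≤ N) {j : ℕ} (hj : j < T) :
    pbLower p q N (j + 1) * (p * (N - j)) = q * (j + 1) * (1 + pbLower p q N j) := by
  have h1 := pbWeight_pos hp hq hN hj
  have h0 := pbWeight_pos hp hq hN hj.le
  have hb := pbWeight_succ (p := p) (N := N) hq j
  rw [pbLower, pbLower, Finset.sum_range_succ]
  rw [show 1 + (∑ i ∈ Finset.range j, pbWeight p q N i) / pbWeight p q N j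
      = (∑ i ∈ Finset.range j, pbWeight p q N i + pbWeight p q N j) / pbWeight p q N j by
    field_simp; ring, div_mul_eq_mul_div, mul_div_assoc', div_eq_div_iff h1.ne' h0.ne']
  linear_combination -(∑ i ∈ Finset.range j, pbWeight p q N i + pbWeight p q N j) * hb

theorem pbUpper_succ (hp : 0 < p) (hq : 0 < q) (hN : (T : ℝ) ≤ N) {j : ℕ} (hj : j < T) :
    pbUpper p q N T j * (q * (j + 1)) = p * (N - j) * (1 + pbUpper p q N T (j + 1)) := by
  have h1 := pbWeight_pos hp hq hN hj
  have h0 := pbWeight_pos hp hq hN hj.le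
  have hb := pbWeight_succ (p := p) (N := N) hq j
  rw [pbUpper, pbUpper, Finset.sum_eq_sum_Ico_succ_bot (by omega : j + 1 < T + 1)]
  set H := ∑ i ∈ Finset.Ico (j + 1 + 1) (T + 1), pbWeight p q N i
  rw [show 1 + H / pbWeight p q N (j + 1)
      = (pbWeight p q N (j + 1) + H) / pbWeight p q N (j + 1) by field_simp,
    div_mul_eq_mul_div, mul_div_assoc', div_eq_div_iff h0.ne' h1.ne']
  linear_combination (pbWeight p q N (j + 1) + H) * hb

theorem pbLower_le_succ (hp : 0 < p) (hq : 0 < q) (hN : (T : ℝ) ≤ N) {j : ℕ} (hj : j < T) :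
    pbLower p q N j ≤ pbLower p q N (j + 1) := by
  induction j with
  | zero => rw [pbLower_zero]; exact pbLower_nonneg hp hq hN hj
  | succ j ih =>
    have hjT : ((j : ℝ) + 1) + 1 ≤ T := by exact_mod_cast hj
    have e1 := pbLower_succ hp hq hN hj
    have e0 := pbLower_succ hp hq hN (j := j) (by omega)
    have i0 := ih (by omega)
    have n0 := pbLower_nonneg hp hq hN (j := j) (by omega)
    have n1 := pbLower_nonneg hp hq hN (j := j + 1) (by omega)
    push_cast at e1
    have hpos : 0 < p * (N - (j + 1)) := mul_pos hp (by linarith)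
    refine le_of_mul_le_mul_right ?_ hpos
    rw [e1]
    have h1 : pbLower p q N (j + 1) * (p * (N - (j + 1))) ≤ pbLower p q N (j + 1) * (p * (N - j)) :=
      mul_le_mul_of_nonneg_left (by nlinarith) n1
    have h2 : q * (j + 1) * (1 + pbLower p q N j)
        ≤ q * ((j + 1) + 1) * (1 + pbLower p q N (j + 1)) :=
      mul_le_mul (by nlinarith) (by linarith) (by linarith) (by positivity)
    linarith

theorem pbUpper_succ_le (hp : 0 < p) (hq : 0 < q) (hN : (T : ℝ) ≤ N) {j : ℕ} (hj : j < T) :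
    pbUpper p q N T (j + 1) ≤ pbUpper p q N T j := by
  induction hd : T - j generalizing j with
  | zero => omega
  | succ d ih =>
    rcases (Nat.succ_le_of_lt hj).eq_or_lt with h | h
    · rw [show j + 1 = T from h, pbUpper_self]
      exact pbUpper_nonneg hp hq hN hj.le
    · have hjT : ((j : ℝ) + 1) + 1 ≤ T := by exact_mod_cast h
      have e0 := pbUpper_succ hp hq hN hj
      have e1 := pbUpper_succ hp hq hN (j := j + 1) h
      have i1 := ih (j := j + 1) h (by omega)
      have n1 := pbUpper_nonneg hp hq hN (j := j + 1) h.le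
      have n2 := pbUpper_nonneg hp hq hN (j := j + 1 + 1) h
      push_cast at e1
      have hpos : 0 < q * ((j : ℝ) + 1) := by positivity
      refine le_of_mul_le_mul_right ?_ hpos
      rw [e0]
      have h1 : pbUpper p q N T (j + 1) * (q * (j + 1))
          ≤ pbUpper p q N T (j + 1) * (q * (j + 1 + 1)) :=
        mul_le_mul_of_nonneg_left (by nlinarith) n1
      have h2 : p * (N - (j + 1)) * (1 + pbUpper p q N T (j + 1 + 1))
          ≤ p * (N - j) * (1 + pbUpper p q N T (j + 1)) :=
        mul_le_mul (by nlinarith) (by linarith) (by linarith)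
          (mul_nonneg hp.le (by linarith))
      linarith

/-- This bound on the mass above `j + 1` keeps the increments of the Stein solution bounded even
when `p q N` is small: with `U = pbUpper j` and `α = p (N - j)` it says `U / α - U ≤ 1 / (j + 1)`.
It is proved by downward induction from the end `T` of the support. -/
theorem one_add_pbUpper_mul_le (hp : 0 < p) (hq : 0 < q) (hpq : p + q = 1) (hN : (T : ℝ) ≤ N)
    {j : ℕ} (hj : j < T) : (1 + pbUpper p q N T (j + 1)) * (1 - p * (N - j)) ≤ q := by
  induction hd : T - j generalizing j with
  | zero => omega
  | succ d ih =>
    have hjT' : (j : ℝ) + 1 ≤ T := by exact_mod_cast hj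
    rcases (Nat.succ_le_of_lt hj).eq_or_lt with h | h
    · rw [show j + 1 = T from h, pbUpper_self]
      nlinarith
    · have e1 := pbUpper_succ hp hq hN (j := j + 1) h
      have i1 := ih (j := j + 1) h (by omega)
      have n1 := pbUpper_nonneg hp hq hN (j := j + 1) h.le
      have n2 := pbUpper_nonneg hp hq hN (j := j + 1 + 1) h
      push_cast at e1 i1
      set U := pbUpper p q N T (j + 1)
      set U' := pbUpper p q N T (j + 1 + 1)
      set a := p * (N - (j + 1)) with ha
      have ha' : p * (N - j) = a + p := by rw [ha]; ring
      rw [ha']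
      have hjT : ((j : ℝ) + 1) + 1 ≤ T := by exact_mod_cast h
      have ha0 : 0 < a := mul_pos hp (by linarith)
      rcases le_or_gt 1 (a + p) with h1 | h1
      · nlinarith
      · -- The recursion turns the inductive bound into `(1 + U) (1 - a) ≤ 1`.
        have h2 : U * (1 - a) ≤ a := by
          have h3 : U * (q * (j + 1 + 1)) * (1 - a) ≤ a * q := by
            rw [e1, mul_assoc]
            exact mul_le_mul_of_nonneg_left i1 ha0.le
          have h4 : U * q * (1 - a) ≤ U * (q * (j + 1 + 1)) * (1 - a) := by
            refine mul_le_mul_of_nonneg_right (mul_le_mul_of_nonneg_left ?_ n1) (by linarith)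
            nlinarith [Nat.cast_nonneg (α := ℝ) j]
          refine le_of_mul_le_mul_right ?_ hq
          linarith
        nlinarith [mul_nonneg hp.le n1]

/-- The counterpart of `one_add_pbUpper_mul_le` for the mass below `j + 1`: with
`L = pbLower (j + 1)` and `β = q (j + 1)` it says `L / β - L ≤ 1 / (N - j)`. -/
theorem one_add_pbLower_mul_le (hp : 0 < p) (hq : 0 < q) (hpq : p + q = 1) (hN : (T : ℝ) ≤ N)
    {j : ℕ} (hj : j < T) : (1 + pbLower p q N j) * (1 - q * (j + 1)) ≤ p := by
  induction j with
  | zero => rw [pbLower_zero]; push_cast; linarith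
  | succ j ih =>
    have e1 := pbLower_succ hp hq hN (j := j) (by omega)
    have i1 := ih (by omega)
    have n1 := pbLower_nonneg hp hq hN (j := j + 1) (by omega)
    have n0 := pbLower_nonneg hp hq hN (j := j) (by omega)
    push_cast
    set L := pbLower p q N (j + 1)
    set L' := pbLower p q N j
    set b := q * ((j : ℝ) + 1) with hb
    have hb' : q * ((j : ℝ) + 1 + 1) = b + q := by rw [hb]; ring
    rw [hb']
    have hjT : ((j : ℝ) + 1) + 1 ≤ T := by exact_mod_cast hj
    have hb0 : 0 < b := by positivity
    rcases le_or_gt 1 (b + q) with h1 | h1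
    · nlinarith
    · have h2 : L * (1 - b) ≤ b := by
        have h3 : L * (p * (N - j)) * (1 - b) ≤ b * p := by
          rw [e1, mul_assoc]
          exact mul_le_mul_of_nonneg_left i1 hb0.le
        have h4 : L * p * (1 - b) ≤ L * (p * (N - j)) * (1 - b) := by
          refine mul_le_mul_of_nonneg_right (mul_le_mul_of_nonneg_left ?_ n1) (by linarith)
          nlinarith
        refine le_of_mul_le_mul_right ?_ hp
        linarith
      nlinarith [mul_nonneg hq.le n1]

theorem sum_pbWeight_pos (hp : 0 < p) (hq : 0 < q) (hN : (T : ℝ) ≤ N) :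
    0 < ∑ i ∈ Finset.range (T + 1), pbWeight p q N i :=
  Finset.sum_pos (fun i hi => pbWeight_pos hp hq hN (Nat.lt_succ_iff.1 (Finset.mem_range.1 hi)))
    ⟨0, by simp⟩

theorem abs_pbMean_le (hp : 0 < p) (hq : 0 < q) (hN : (T : ℝ) ≤ N) {f : ℕ → ℝ}
    (hf : ∀ k, |f k| ≤ 1) : |pbMean p q N T f| ≤ 1 := by
  have hZ := sum_pbWeight_pos hp hq hN
  rw [pbMean, abs_div, abs_of_pos hZ, div_le_one hZ]
  refine (Finset.abs_sum_le_sum_abs _ _).trans (Finset.sum_le_sum fun i hi => ?_)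
  have := pbWeight_pos hp hq hN (Nat.lt_succ_iff.1 (Finset.mem_range.1 hi))
  rw [abs_mul, abs_of_pos this]
  exact mul_le_of_le_one_right this.le (hf i)

theorem sum_pbWeight_mul_sub_pbMean (hp : 0 < p) (hq : 0 < q) (hN : (T : ℝ) ≤ N) (f : ℕ → ℝ) :
    ∑ i ∈ Finset.range (T + 1), pbWeight p q N i * (f i - pbMean p q N T f) = 0 := by
  have hZ := sum_pbWeight_pos hp hq hN
  simp only [mul_sub, Finset.sum_sub_distrib, ← Finset.sum_mul]
  rw [pbMean, mul_div_cancel₀ _ hZ.ne', sub_self]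

theorem pbSol_of_lt {f : ℕ → ℝ} {j : ℕ} (hj : T < j) : pbSol p q N T f j = 0 := by
  rw [pbSol, if_neg (by omega)]

theorem mul_pbSol (hp : 0 < p) (hq : 0 < q) (hN : (T : ℝ) ≤ N) (f : ℕ → ℝ) {j : ℕ} (hj : j ≤ T) :
    q * j * pbSol p q N T f j
      = (∑ i ∈ Finset.range j, pbWeight p q N i * (f i - pbMean p q N T f)) /
        pbWeight p q N j := by
  rcases Nat.eq_zero_or_pos j with rfl | hj0
  · simp
  · have := pbWeight_pos hp hq hN hj
    rw [pbSol, if_pos hj]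
    field_simp

/-- The Stein equation of the truncated pseudo-binomial law. At `j = T` it holds with
`pbSol (T + 1) = 0` because `f - pbMean f` has mean zero. -/
theorem pbSol_eq (hp : 0 < p) (hq : 0 < q) (hN : (T : ℝ) ≤ N) (f : ℕ → ℝ) {j : ℕ} (hj : j ≤ T) :
    p * (N - j) * pbSol p q N T f (j + 1) - q * j * pbSol p q N T f j
      = f j - pbMean p q N T f := by
  have hw := pbWeight_pos hp hq hN hj
  rw [mul_pbSol hp hq hN f hj]
  rcases hj.eq_or_lt with rfl | hlt
  · have h0 := sum_pbWeight_mul_sub_pbMean hp hq hN f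
    rw [Finset.sum_range_succ] at h0
    rw [pbSol_of_lt (Nat.lt_succ_self _)]
    field_simp
    linarith
  · have hw1 := pbWeight_pos hp hq hN hlt
    have hb := pbWeight_succ (p := p) (N := N) hq j
    rw [pbSol, if_pos (Nat.succ_le_of_lt hlt)]
    push_cast
    rw [hb, Finset.sum_range_succ]
    have hjT : (j : ℝ) + 1 ≤ T := by exact_mod_cast hlt
    have : N - j ≠ 0 := by linarith
    field_simp
    ring

/-- The increment of the Stein solution at `j` is a combination of the values of `f` below, at and
above `j` whose coefficients sum to zero and of which only the one at `j` is positive. -/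
theorem abs_increment_le {s r w F L U x y e b : ℝ} (hw : 0 < w)
    (hs : |s| ≤ L * w) (hr : |r| ≤ U * w) (hF : |F| ≤ 1) (hx : 0 ≤ x) (he : 0 ≤ e)
    (hxb : x ≤ b) (hey : e ≤ y) (hUy : U * y = x * (1 + L)) (hLb : L * b = e * (1 + U)) :
    |s * (x - b) + w * F * (x + e) + r * (e - y)| ≤ 2 * w * (x + e) := by
  have h1 : |s * (x - b)| ≤ L * w * (b - x) := by
    rw [abs_mul, abs_of_nonpos (sub_nonpos.2 hxb), neg_sub]
    exact mul_le_mul_of_nonneg_right hs (sub_nonneg.2 hxb)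
  have h2 : |r * (e - y)| ≤ U * w * (y - e) := by
    rw [abs_mul, abs_of_nonpos (sub_nonpos.2 hey), neg_sub]
    exact mul_le_mul_of_nonneg_right hr (sub_nonneg.2 hey)
  have h3 : |w * F * (x + e)| ≤ w * (x + e) := by
    rw [abs_mul, abs_mul, abs_of_pos hw, abs_of_nonneg (add_nonneg hx he)]
    exact mul_le_mul_of_nonneg_right (mul_le_of_le_one_right hw.le hF) (add_nonneg hx he)
  calc |s * (x - b) + w * F * (x + e) + r * (e - y)|
      ≤ |s * (x - b)| + |w * F * (x + e)| + |r * (e - y)| := abs_add_three _ _ _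
    _ ≤ L * w * (b - x) + w * (x + e) + U * w * (y - e) := by linarith
    _ = 2 * w * (x + e) := by linear_combination w * hUy + w * hLb

/-- The two bounds on the mass below `j + 1` divided by the death rate: the first one leads to
increments of order `1 / (p q N)`, the second one to increments of order one. -/
theorem pbLower_div_bounds (hp : 0 < p) (hq : 0 < q) (hpq : p + q = 1) (hN : (T : ℝ) ≤ N)
    {j : ℕ} (hj : j < T) :
    p * (N - (j + 1)) * (pbLower p q N (j + 1) / (q * (j + 1))) ≤ 1 + pbLower p q N (j + 1) ∧
      (pbLower p q N (j + 1) / (q * (j + 1)) - pbLower p q N (j + 1)) * (N - j) ≤ 1 := by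
  have hjT : (j : ℝ) + 1 ≤ T := by exact_mod_cast hj
  have hβ : 0 < q * ((j : ℝ) + 1) := by positivity
  have hN' : 0 < N - j := by linarith
  have hrec := pbLower_succ hp hq hN hj
  have hmono := pbLower_le_succ hp hq hN hj
  have hclaim := one_add_pbLower_mul_le hp hq hpq hN hj
  have hn := pbLower_nonneg hp hq hN (j := j + 1) hj
  set L := pbLower p q N (j + 1)
  set L' := pbLower p q N j
  set e := L / (q * (j + 1)) with he
  have heL : e * (q * (j + 1)) = L := div_mul_cancel₀ _ hβ.ne'
  have he0 : 0 ≤ e := div_nonneg hn hβ.le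
  have hα : e * (p * (N - j)) = 1 + L' := by
    refine mul_left_cancel₀ hβ.ne' ?_
    linear_combination hrec + p * (N - j) * heL
  constructor
  · nlinarith [mul_nonneg hp.le he0]
  · refine le_of_mul_le_mul_left ?_ hp
    have : p * ((e - L) * (N - j)) = (1 + L') * (1 - q * (j + 1)) := by
      linear_combination (1 - q * (j + 1)) * hα + p * (N - j) * heL
    rw [this, mul_one]
    exact hclaim

/-- The two bounds on the mass above `j` divided by the birth rate, as in `pbLower_div_bounds`. -/
theorem pbUpper_div_bounds (hp : 0 < p) (hq : 0 < q) (hpq : p + q = 1) (hN : (T : ℝ) ≤ N)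
    {j : ℕ} (hj : j < T) :
    q * j * (pbUpper p q N T j / (p * (N - j))) ≤ 1 + pbUpper p q N T j ∧
      (pbUpper p q N T j / (p * (N - j)) - pbUpper p q N T j) * (j + 1) ≤ 1 := by
  have hjT : (j : ℝ) + 1 ≤ T := by exact_mod_cast hj
  have hα : 0 < p * (N - j) := mul_pos hp (by linarith)
  have hrec := pbUpper_succ hp hq hN hj
  have hmono := pbUpper_succ_le hp hq hN hj
  have hclaim := one_add_pbUpper_mul_le hp hq hpq hN hj
  have hn := pbUpper_nonneg hp hq hN hj.le
  set U := pbUpper p q N T j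
  set U' := pbUpper p q N T (j + 1)
  set x := U / (p * (N - j)) with hx
  have hxU : x * (p * (N - j)) = U := div_mul_cancel₀ _ hα.ne'
  have hx0 : 0 ≤ x := div_nonneg hn hα.le
  have hβ : x * (q * (j + 1)) = 1 + U' := by
    refine mul_left_cancel₀ hα.ne' ?_
    linear_combination hrec + q * (j + 1) * hxU
  constructor
  · nlinarith [mul_nonneg hq.le hx0]
  · refine le_of_mul_le_mul_left ?_ hq
    have : q * ((x - U) * (j + 1)) = (1 + U') * (1 - p * (N - j)) := by
      linear_combination (1 - p * (N - j)) * hβ + q * (j + 1) * hxU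
    rw [this, mul_one]
    exact hclaim

theorem le_one_div_of_mul_le_one {t m c : ℝ} (hc : 0 < c) (hcm : c ≤ m) (h : t * m ≤ 1) :
    t ≤ 1 / c := by
  rw [le_div_iff₀ hc]
  rcases le_total t 0 with ht | ht
  · exact (mul_nonpos_of_nonpos_of_nonneg ht hc.le).trans zero_le_one
  · exact (mul_le_mul_of_nonneg_left hcm ht).trans h

/-- The increment of the Stein solution in terms of the relative masses `L`, `U` below and above
`j`; `x` and `e` are `U` and `L` divided by the birth and the death rate. -/
theorem abs_pbSol_diff_mul_le (hp : 0 < p) (hq : 0 < q) (hpq : p + q = 1) (hN : (T : ℝ) ≤ N)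
    {f : ℕ → ℝ} (hf : ∀ k, |f k| ≤ 1) {j : ℕ} (hj : j < T) :
    ∃ x, 0 ≤ x ∧ q * ((j : ℝ) + 1) * x ≤ 1 + pbUpper p q N T (j + 1) ∧
      p * (N - ((j : ℝ) + 1)) * x ≤ pbUpper p q N T (j + 1) ∧
      x - pbUpper p q N T (j + 1) +
        (pbLower p q N (j + 1) / (q * (j + 1)) - pbLower p q N (j + 1)) ≤ 1 ∧
      |pbSol p q N T f (j + 1 + 1) - pbSol p q N T f (j + 1)| *
          (1 + pbUpper p q N T (j + 1) + pbLower p q N (j + 1))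
        ≤ 2 * (x + pbLower p q N (j + 1) / (q * (j + 1))) := by
  have hjT : (j : ℝ) + 1 ≤ T := by exact_mod_cast hj
  have hβ : 0 < q * ((j : ℝ) + 1) := by positivity
  have hw := pbWeight_pos hp hq hN (Nat.succ_le_of_lt hj)
  have hn := pbLower_nonneg hp hq hN (j := j + 1) hj
  have hU := pbUpper_nonneg hp hq hN (j := j + 1) hj
  obtain ⟨hl1, hl2⟩ := pbLower_div_bounds hp hq hpq hN hj
  have hZpos := sum_pbWeight_pos hp hq hN
  have hsplit : ∀ h : ℕ → ℝ, ∑ i ∈ Finset.range (T + 1), h i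
      = ∑ i ∈ Finset.range (j + 1), h i + h (j + 1)
        + ∑ i ∈ Finset.Ico (j + 1 + 1) (T + 1), h i := by
    intro h
    rw [← Finset.sum_range_succ, Finset.sum_range_add_sum_Ico _ (by omega)]
  have hlo : ∑ i ∈ Finset.range (j + 1), pbWeight p q N i
      = pbLower p q N (j + 1) * pbWeight p q N (j + 1) := (div_mul_cancel₀ _ hw.ne').symm
  have hhi : ∑ i ∈ Finset.Ico (j + 1 + 1) (T + 1), pbWeight p q N i
      = pbUpper p q N T (j + 1) * pbWeight p q N (j + 1) := (div_mul_cancel₀ _ hw.ne').symm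
  have hZ := hsplit (pbWeight p q N)
  have hC := hsplit (fun i => pbWeight p q N i * f i)
  have hmean : pbMean p q N T f * ∑ i ∈ Finset.range (T + 1), pbWeight p q N i
      = ∑ i ∈ Finset.range (T + 1), pbWeight p q N i * f i := div_mul_cancel₀ _ hZpos.ne'
  have habs : ∀ A : Finset ℕ, (∀ i ∈ A, i ≤ T) →
      |∑ i ∈ A, pbWeight p q N i * f i| ≤ ∑ i ∈ A, pbWeight p q N i := by
    intro A hA
    refine (Finset.abs_sum_le_sum_abs _ _).trans (Finset.sum_le_sum fun i hi => ?_)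
    have := pbWeight_pos hp hq hN (hA i hi)
    rw [abs_mul, abs_of_pos this]
    exact mul_le_of_le_one_right this.le (hf i)
  have hs := habs (Finset.range (j + 1)) (fun i hi => by have := Finset.mem_range.1 hi; omega)
  have hr := habs (Finset.Ico (j + 1 + 1) (T + 1))
    (fun i hi => by have := Finset.mem_Ico.1 hi; omega)
  rw [hlo] at hs
  rw [hhi] at hr
  have hg0 : pbSol p q N T f (j + 1) * (q * (j + 1) * pbWeight p q N (j + 1))
      = ∑ i ∈ Finset.range (j + 1), pbWeight p q N i * f i
        - pbMean p q N T f * (pbLower p q N (j + 1) * pbWeight p q N (j + 1)) := by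
    rw [pbSol, if_pos (Nat.succ_le_of_lt hj), Nat.cast_add, Nat.cast_one,
      div_mul_cancel₀ _ (mul_pos hβ hw).ne', ← hlo, Finset.mul_sum, ← Finset.sum_sub_distrib]
    exact Finset.sum_congr rfl fun i _ => by ring
  have hstein := pbSol_eq hp hq hN f (Nat.succ_le_of_lt hj)
  rw [Nat.succ_eq_add_one, Nat.cast_add, Nat.cast_one] at hstein
  set g := pbSol p q N T f (j + 1)
  set g' := pbSol p q N T f (j + 1 + 1) with hg'
  set w := pbWeight p q N (j + 1)
  set L := pbLower p q N (j + 1)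
  set U := pbUpper p q N T (j + 1) with hUdef
  set s := ∑ i ∈ Finset.range (j + 1), pbWeight p q N i * f i
  set r := ∑ i ∈ Finset.Ico (j + 1 + 1) (T + 1), pbWeight p q N i * f i with hrdef
  set c := pbMean p q N T f
  set Z := ∑ i ∈ Finset.range (T + 1), pbWeight p q N i
  set F := f (j + 1) with hF
  have hZ' : Z = w * (1 + U + L) := by rw [hZ, hlo, hhi]; ring
  have hc : c * (w * (1 + U + L)) = s + w * F + r := by rw [← hZ', hmean, hC]
  set e := L / (q * (j + 1)) with he
  have heL : e * (q * (j + 1)) = L := div_mul_cancel₀ _ hβ.ne'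
  have he0 : 0 ≤ e := div_nonneg hn hβ.le
  set b := (1 + U) / (q * (j + 1)) with hb
  have hbU : b * (q * (j + 1)) = 1 + U := div_mul_cancel₀ _ hβ.ne'
  have hLb : L * b = e * (1 + U) := by rw [hb, he]; ring
  have hgZ : g * (w * (1 + U + L)) = s * b - (w * F + r) * e := by
    refine mul_right_cancel₀ hβ.ne' ?_
    linear_combination (1 + U + L) * hg0 - L * hc - s * hbU + (w * F + r) * heL
  rcases (Nat.succ_le_of_lt hj).eq_or_lt with hT | hT
  · -- At the upper end of the support the solution jumps to zero.
    have hT' : j + 1 = T := hT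
    have hU0 : U = 0 := by rw [hUdef, hT', pbUpper_self]
    have hr0 : r = 0 := by rw [hrdef, hT', Finset.Ico_self, Finset.sum_empty]
    have hg0' : g' = 0 := by rw [hg', pbSol_of_lt (by omega)]
    have hN1 : (1 : ℝ) ≤ N - j := by linarith
    refine ⟨0, le_rfl, by rw [mul_zero]; linarith, by rw [mul_zero]; exact hU, ?_, ?_⟩
    · rw [hU0, sub_zero, zero_add, ← div_one 1]
      exact le_one_div_of_mul_le_one one_pos hN1 hl2
    · have h := abs_increment_le (y := e) hw hs hr (hf (j + 1)) le_rfl he0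
        (div_nonneg (by linarith) hβ.le) le_rfl (by rw [hU0]; ring) hLb
      refine le_of_mul_le_mul_left ?_ hw
      calc w * (|g' - g| * (1 + U + L)) = |g * (w * (1 + U + L))| := by
            rw [hg0', zero_sub, abs_neg, abs_mul, abs_of_pos (mul_pos hw (by linarith))]; ring
        _ = |s * (0 - b) + w * F * (0 + e) + r * (e - e)| := by
            rw [hgZ, hr0, ← abs_neg]; congr 1; ring
        _ ≤ 2 * w * (0 + e) := h
        _ = w * (2 * (0 + e)) := by ring
  · have hT2 : ((j : ℝ) + 1) + 1 ≤ T := by exact_mod_cast hT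
    have hα : 0 < p * (N - (j + 1)) := mul_pos hp (by linarith)
    obtain ⟨hu1, hu2⟩ := pbUpper_div_bounds hp hq hpq hN (j := j + 1) hT
    rw [← hUdef] at hu1 hu2
    push_cast at hu1 hu2
    set x := U / (p * (N - (j + 1))) with hx
    have hxU : x * (p * (N - (j + 1))) = U := div_mul_cancel₀ _ hα.ne'
    have hx0 : 0 ≤ x := div_nonneg hU hα.le
    set y := (1 + L) / (p * (N - (j + 1))) with hy
    have hyL : y * (p * (N - (j + 1))) = 1 + L := div_mul_cancel₀ _ hα.ne'
    have hUy : U * y = x * (1 + L) := by rw [hx, hy]; ring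
    have hxb : x ≤ b := by rw [hb, le_div_iff₀ hβ]; linarith
    have hey : e ≤ y := by rw [hy, le_div_iff₀ hα]; linarith
    refine ⟨x, hx0, hu1, by linarith, ?_, ?_⟩
    · have h1 : x - U ≤ 1 / 2 :=
        le_one_div_of_mul_le_one two_pos (by linarith [Nat.cast_nonneg (α := ℝ) j]) hu2
      have h2 : e - L ≤ 1 / 2 := le_one_div_of_mul_le_one two_pos (by linarith) hl2
      linarith
    · have hg'Z : g' * (w * (1 + U + L)) = (s + w * F) * x - r * y := by
        refine mul_right_cancel₀ hα.ne' ?_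
        linear_combination w * (1 + U + L) * hstein + (1 + U + L) * hg0 - (1 + L) * hc
          - (s + w * F) * hxU + r * hyL
      have h := abs_increment_le hw hs hr (hf (j + 1)) hx0 he0 hxb hey hUy hLb
      refine le_of_mul_le_mul_left ?_ hw
      calc w * (|g' - g| * (1 + U + L)) = |(g' - g) * (w * (1 + U + L))| := by
            rw [abs_mul, abs_of_pos (mul_pos hw (by linarith : 0 < 1 + U + L))]; ring
        _ = |s * (x - b) + w * F * (x + e) + r * (e - y)| := by
            rw [sub_mul, hg'Z, hgZ]; congr 1; ring
        _ ≤ 2 * w * (x + e) := h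
        _ = w * (2 * (x + e)) := by ring

/-- The increments of the Stein solution are bounded both by a constant and by the inverse of the
variance `p q N`. The increment at zero is excluded. -/
theorem abs_pbSol_diff_le (hp : 0 < p) (hq : 0 < q) (hpq : p + q = 1) (hN : (T : ℝ) ≤ N)
    {f : ℕ → ℝ} (hf : ∀ k, |f k| ≤ 1) (j : ℕ) :
    |pbSol p q N T f (j + 2) - pbSol p q N T f (j + 1)| ≤ 2 ∧
      |pbSol p q N T f (j + 2) - pbSol p q N T f (j + 1)| * (p * q * N) ≤ 2 := by
  rcases Nat.lt_or_ge j T with hj | hj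
  · obtain ⟨x, hx0, hx1, hx2, hx3, hmain⟩ := abs_pbSol_diff_mul_le hp hq hpq hN hf hj
    obtain ⟨hl1, hl2⟩ := pbLower_div_bounds hp hq hpq hN hj
    have hn := pbLower_nonneg hp hq hN (j := j + 1) hj
    have hU := pbUpper_nonneg hp hq hN (j := j + 1) hj
    have hβ : 0 < q * ((j : ℝ) + 1) := by positivity
    set D := |pbSol p q N T f (j + 2) - pbSol p q N T f (j + 1)|
    have hD : 0 ≤ D := abs_nonneg _
    set L := pbLower p q N (j + 1)
    set U := pbUpper p q N T (j + 1)
    set e := L / (q * (j + 1)) with he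
    have heL : e * (q * (j + 1)) = L := div_mul_cancel₀ _ hβ.ne'
    have hK : 0 < 1 + U + L := by linarith
    have hN0 : 0 ≤ N := (Nat.cast_nonneg T).trans hN
    constructor
    · refine le_of_mul_le_mul_right ?_ hK
      linarith
    · refine le_of_mul_le_mul_right ?_ hK
      have h1 : (x + e) * (p * q * N) ≤ 1 + U + L := by
        have h2 : p * (q * (j + 1) * (x + e)) ≤ p * (1 + U + L) :=
          mul_le_mul_of_nonneg_left (by linarith) hp.le
        have h3 : q * (p * (N - (j + 1)) * (x + e)) ≤ q * (1 + U + L) :=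
          mul_le_mul_of_nonneg_left (by linarith) hq.le
        have h4 : (x + e) * (p * q * N)
            = p * (q * (j + 1) * (x + e)) + q * (p * (N - (j + 1)) * (x + e)) := by ring
        have h5 : p * (1 + U + L) + q * (1 + U + L) = 1 + U + L := by rw [← add_mul, hpq, one_mul]
        linarith
      calc D * (p * q * N) * (1 + U + L) = D * (1 + U + L) * (p * q * N) := by ring
        _ ≤ 2 * (x + e) * (p * q * N) := mul_le_mul_of_nonneg_right hmain (by positivity)
        _ ≤ 2 * (1 + U + L) := by linarith
  · rw [pbSol_of_lt (by omega), pbSol_of_lt (by omega)]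
    simp

end PseudoBinomial

/-! ### The Stein operator under the law of the sum -/

section SteinOperator

variable {ι : Type*} [DecidableEq ι] [Fintype ι] {p : ι → ℝ}

/-- The Stein operator of the law of `Y₁ + Y₂`, for `Y₁` Poisson with parameter `a` and `Y₂`
binomial with success probability `P`, written with the mean `m` of the law: a pseudo-binomial
operator with `m / P` trials, perturbed by `a P` times a difference. -/
def bcpStein (P m a : ℝ) (g : ℕ → ℝ) (k : ℕ) : ℝ :=
  (m - P * k) * g (k + 1) - (1 - P) * k * g k + a * P * (g (k + 2) - g (k + 1))

/-- One step of the expansion of the Stein operator around the law of the sum. -/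
theorem bernExp_bcpStein (P a : ℝ) (g : ℕ → ℝ) :
    bernExp p Finset.univ (bcpStein P (∑ i, p i) a g)
      = ∑ i, p i * (p i - P) *
          bernExp p (Finset.univ.erase i) (fun k => g (k + 2) - g (k + 1))
        + a * P * bernExp p Finset.univ (fun k => g (k + 2) - g (k + 1)) := by
  have hA : bcpStein P (∑ i, p i) a g = fun k : ℕ =>
      (((∑ i, p i) * g (k + 1) - P * (k * g (k + 1))) - (1 - P) * (k * g k))
        + a * P * (g (k + 2) - g (k + 1)) := by
    funext k; rw [bcpStein]; ring
  rw [hA, bernExp_add, bernExp_sub, bernExp_sub, bernExp_const_mul, bernExp_const_mul,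
    bernExp_const_mul, bernExp_const_mul, bernExp_natCast_mul,
    bernExp_natCast_mul Finset.univ g, Finset.sum_mul, Finset.mul_sum,
    Finset.mul_sum, ← Finset.sum_sub_distrib, ← Finset.sum_sub_distrib]
  congr 1
  refine Finset.sum_congr rfl fun i _ => ?_
  rw [bernExp_eq_erase (Finset.mem_univ i) (fun k => g (k + 1)), bernExp_sub]
  ring

theorem weighted_covariance_eq {κ : Type*} [Fintype κ] (w x h : κ → ℝ) {P : ℝ}
    (hP : P * ∑ i, w i = ∑ i, w i * x i) :
    2 * ((∑ i, w i) * ∑ i, w i * (x i - P) * h i)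
      = ∑ i, ∑ j, w i * w j * ((x i - x j) * (h i - h j)) := by
  have h1 : ∑ i, ∑ j, w i * w j * ((x i - x j) * (h i - h j))
      = 2 * ((∑ i, w i) * (∑ i, w i * x i * h i) - (∑ i, w i * x i) * ∑ i, w i * h i) := by
    have e : ∀ i j, w i * w j * ((x i - x j) * (h i - h j))
        = w i * x i * h i * w j - w i * x i * (w j * h j) - w i * h i * (w j * x j)
          + w i * (w j * x j * h j) := fun i j => by ring
    simp only [e, Finset.sum_add_distrib, Finset.sum_sub_distrib, ← Finset.sum_mul_sum]
    ring
  have h2 : ∑ i, w i * (x i - P) * h i = ∑ i, w i * x i * h i - P * ∑ i, w i * h i := by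
    rw [Finset.mul_sum, ← Finset.sum_sub_distrib]
    exact Finset.sum_congr rfl fun i _ => by ring
  rw [h1, h2]
  linear_combination (-2 * ∑ i, w i * h i) * hP

/-- The expectation of the Stein operator under the law of the sum. The first-order coefficient is
the mismatch of variances. The next term is a covariance, with weights `pᵢ²`, between `pᵢ` and a
mean second difference: as the weighted mean of the `pᵢ` is `P`, it is a sum over pairs in which
only third differences of `g`, taken without the two indicators of the pair, appear. -/
theorem abs_bernExp_bcpStein_le {P a K B : ℝ} {g : ℕ → ℝ} (hS2 : 0 < ∑ i, p i ^ 2)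
    (hP : P * ∑ i, p i ^ 2 = ∑ i, p i ^ 3)
    (hB : |bernExp p Finset.univ (fun k => g (k + 2) - g (k + 1))| ≤ B)
    (hK : ∀ i j, i ≠ j → |bernExp p ((Finset.univ.erase i).erase j) (fun k =>
      ((g (k + 4) - g (k + 3)) - (g (k + 3) - g (k + 2)))
        - ((g (k + 3) - g (k + 2)) - (g (k + 2) - g (k + 1))))| ≤ K) :
    |bernExp p Finset.univ (bcpStein P (∑ i, p i) a g)|
      ≤ |∑ i, p i ^ 2 - P * ∑ i, p i + a * P| * B
        + (∑ i, p i ^ 4 - P * ∑ i, p i ^ 3) * K := by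
  set H : ℕ → ℝ := fun k => g (k + 2) - g (k + 1) with hH
  set D : ι → ℝ := fun i => bernExp p (Finset.univ.erase i) (fun k => H (k + 1) - H k) with hD
  have h1 : bernExp p Finset.univ (bcpStein P (∑ i, p i) a g)
      = (∑ i, p i ^ 2 - P * ∑ i, p i + a * P) * bernExp p Finset.univ H
        - ∑ i, p i ^ 2 * (p i - P) * D i := by
    have e : ∀ i, p i * (p i - P) * bernExp p (Finset.univ.erase i) H
        = (p i ^ 2 - P * p i) * bernExp p Finset.univ H - p i ^ 2 * (p i - P) * D i := fun i => by
      rw [bernExp_eq_erase (Finset.mem_univ i) H]; ring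
    rw [bernExp_bcpStein, Finset.sum_congr rfl fun i _ => e i, Finset.sum_sub_distrib,
      ← Finset.sum_mul, Finset.sum_sub_distrib, ← Finset.mul_sum]
    ring
  have hpair : ∀ i j, |p i ^ 2 * p j ^ 2 * ((p i - p j) * (D i - D j))|
      ≤ p i ^ 2 * p j ^ 2 * ((p i - p j) * (p i - p j)) * K := by
    intro i j
    rcases eq_or_ne i j with rfl | hij
    · simp
    · have hDij : D i - D j = (p j - p i) * bernExp p ((Finset.univ.erase i).erase j) (fun k =>
          (H (k + 1 + 1) - H (k + 1)) - (H (k + 1) - H k)) := by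
        rw [hD]
        dsimp only
        rw [bernExp_eq_erase (Finset.mem_erase.2 ⟨hij.symm, Finset.mem_univ j⟩)
            (fun k => H (k + 1) - H k),
          bernExp_eq_erase (Finset.mem_erase.2 ⟨hij, Finset.mem_univ i⟩)
            (fun k => H (k + 1) - H k), Finset.erase_right_comm (a := j) (b := i)]
        ring
      rw [hDij, show p i ^ 2 * p j ^ 2 * ((p i - p j) * ((p j - p i) *
          bernExp p ((Finset.univ.erase i).erase j) (fun k =>
            (H (k + 1 + 1) - H (k + 1)) - (H (k + 1) - H k))))
        = -(p i ^ 2 * p j ^ 2 * ((p i - p j) * (p i - p j)) *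
          bernExp p ((Finset.univ.erase i).erase j) (fun k =>
            (H (k + 1 + 1) - H (k + 1)) - (H (k + 1) - H k))) by ring, abs_neg, abs_mul]
      have h0 : 0 ≤ p i ^ 2 * p j ^ 2 * ((p i - p j) * (p i - p j)) :=
        mul_nonneg (by positivity) (mul_self_nonneg _)
      rw [abs_of_nonneg h0]
      exact mul_le_mul_of_nonneg_left (hK i j hij) h0
  have hsq : ∀ i, p i ^ 2 * p i = p i ^ 3 := fun i => by ring
  have hP' : P * ∑ i, p i ^ 2 = ∑ i, p i ^ 2 * p i := by simp only [hsq, hP]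
  have hcov := weighted_covariance_eq (fun i => p i ^ 2) p D hP'
  have hvar := weighted_covariance_eq (fun i => p i ^ 2) p p hP'
  have hvar' : ∑ i, p i ^ 2 * (p i - P) * p i = ∑ i, p i ^ 4 - P * ∑ i, p i ^ 3 := by
    rw [Finset.mul_sum, ← Finset.sum_sub_distrib]
    exact Finset.sum_congr rfl fun i _ => by ring
  have hR : |∑ i, p i ^ 2 * (p i - P) * D i| ≤ (∑ i, p i ^ 4 - P * ∑ i, p i ^ 3) * K := by
    have h2 : 0 < 2 * ∑ i, p i ^ 2 := by linarith
    refine le_of_mul_le_mul_left ?_ h2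
    calc 2 * (∑ i, p i ^ 2) * |∑ i, p i ^ 2 * (p i - P) * D i|
        = |∑ i, ∑ j, p i ^ 2 * p j ^ 2 * ((p i - p j) * (D i - D j))| := by
          rw [← hcov, ← mul_assoc, abs_mul, abs_of_pos h2]
      _ ≤ ∑ i, ∑ j, p i ^ 2 * p j ^ 2 * ((p i - p j) * (p i - p j)) * K := by
          refine (Finset.abs_sum_le_sum_abs _ _).trans (Finset.sum_le_sum fun i _ => ?_)
          exact (Finset.abs_sum_le_sum_abs _ _).trans (Finset.sum_le_sum fun j _ => hpair i j)
      _ = 2 * (∑ i, p i ^ 2) * ((∑ i, p i ^ 4 - P * ∑ i, p i ^ 3) * K) := by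
          simp only [← Finset.sum_mul]
          rw [← hvar, hvar']
          ring
  rw [h1]
  refine (abs_sub _ _).trans (add_le_add ?_ hR)
  rw [abs_mul]
  exact mul_le_mul_of_nonneg_left hB (abs_nonneg _)

end SteinOperator

/-! ### The convolution of a Poisson and a binomial law -/

section StationaryLaw

theorem integral_poisson_stein (a : NNReal) {v : ℕ → ℝ} {T : ℕ} (hv : ∀ k, T < k → v k = 0) :
    ∫ x, (a * v (x + 1) - x * v x) ∂poissonMeasure a = 0 := by
  rw [integral_poissonMeasure, tsum_eq_sum (s := Finset.range (T + 1))]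
  · have h : ∀ k : ℕ, (Real.exp (-a) * a ^ k / k.factorial) • (a * v (k + 1) - k * v k)
        = Real.exp (-a) * a ^ (k + 1) / (k + 1).factorial * ((k + 1 : ℕ) * v (k + 1))
          - Real.exp (-a) * a ^ k / k.factorial * (k * v k) := by
      intro k
      have : (k.factorial : ℝ) ≠ 0 := by positivity
      rw [Nat.factorial_succ, smul_eq_mul]
      push_cast
      field_simp
      ring
    rw [Finset.sum_congr rfl fun k _ => h k,
      Finset.sum_range_sub (fun k : ℕ => Real.exp (-a) * a ^ k / k.factorial * (k * v k)),
      hv _ (Nat.lt_succ_self T)]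
    simp
  · intro k hk
    have hk' : T < k := by simpa using hk
    rw [hv k hk', hv (k + 1) (by omega)]
    simp

theorem integral_binomial_stein (M : ℕ) (P : Set.Icc (0 : ℝ) 1) (v : ℕ → ℝ) :
    ∫ y, ((P : ℝ) * (M - y) * v (y + 1) - (1 - P) * y * v y) ∂binomial M P = 0 := by
  rw [integral_binomial]
  have h : ∀ k ∈ Finset.range (M + 1),
      ((M.choose k : ℝ) * (P : ℝ) ^ k * (1 - (P : ℝ)) ^ (M - k)) •
          ((P : ℝ) * (M - k) * v (k + 1) - (1 - P) * k * v k)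
        = (1 - (P : ℝ)) * ((M.choose (k + 1) : ℝ) * (P : ℝ) ^ (k + 1) *
            (1 - (P : ℝ)) ^ (M - (k + 1))) * ((k + 1 : ℕ) * v (k + 1))
          - (1 - (P : ℝ)) * ((M.choose k : ℝ) * (P : ℝ) ^ k * (1 - (P : ℝ)) ^ (M - k)) *
            (k * v k) := by
    intro k hk
    have hkM : k ≤ M := Nat.lt_succ_iff.1 (Finset.mem_range.1 hk)
    have hch : (M.choose (k + 1) : ℝ) * (k + 1) = M.choose k * (M - k) := by
      have := Nat.choose_succ_right_eq M k
      rw [← Nat.cast_sub hkM]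
      exact_mod_cast this
    rw [smul_eq_mul]
    push_cast
    rcases hkM.eq_or_lt with rfl | hlt
    · simp
      ring
    · have hpow : (1 - (P : ℝ)) ^ (M - k) = (1 - (P : ℝ)) * (1 - (P : ℝ)) ^ (M - (k + 1)) := by
        rw [← pow_succ', show M - (k + 1) + 1 = M - k by omega]
      rw [hpow]
      linear_combination (-(1 - (P : ℝ)) * (1 - (P : ℝ)) ^ (M - (k + 1)) * (P : ℝ) ^ (k + 1)
        * v (k + 1)) * hch
  rw [show Finset.Iic M = Finset.range (M + 1) by ext; simp,
    Finset.sum_congr rfl h, Finset.sum_range_sub (fun k : ℕ =>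
      (1 - (P : ℝ)) * ((M.choose k : ℝ) * (P : ℝ) ^ k * (1 - (P : ℝ)) ^ (M - k)) * (k * v k))]
  simp

theorem integrable_of_finite_support {E : Type*} [MeasurableSpace E] [Countable E]
    [MeasurableSingletonClass E] (ν : Measure E) [IsFiniteMeasure ν] {F : E → ℝ} {A : Finset E}
    (hF : ∀ z, z ∉ A → F z = 0) : Integrable F ν := by
  refine Integrable.of_bound (measurable_of_countable F).aestronglyMeasurable
    (∑ z ∈ A, |F z|) (Filter.Eventually.of_forall fun z => ?_)
  by_cases hz : z ∈ A
  · exact Finset.single_le_sum (f := fun z => |F z|) (fun _ _ => abs_nonneg _) hz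
  · rw [hF z hz, norm_zero]
    exact Finset.sum_nonneg fun _ _ => abs_nonneg _

/-- The Stein operator annihilates the law of the sum of independent Poisson and binomial
variables. -/
theorem integral_bcpStein_conv (a : NNReal) (M : ℕ) (P : Set.Icc (0 : ℝ) 1) {g : ℕ → ℝ} {T : ℕ}
    (hg : ∀ k, T < k → g k = 0) :
    ∫ k, bcpStein P (a + M * P) a g k ∂(Measure.conv (poissonMeasure a) (binomial M P)) = 0 := by
  have hint : Integrable (bcpStein P (a + M * P) a g)
      (Measure.conv (poissonMeasure a) (binomial M P)) :=
    integrable_of_finite_support _ (A := Finset.range (T + 1)) fun k hk => by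
      have hk' : T < k := by simpa using hk
      rw [bcpStein, hg k hk', hg (k + 1) (by omega), hg (k + 2) (by omega)]
      ring
  rw [integral_conv hint]
  -- The Poisson identity is applied for fixed `y` and the binomial identity for fixed `x`.
  set F₁ : ℕ → ℕ → ℝ := fun x y =>
    a * (P * g (x + 1 + y + 1) + (1 - P) * g (x + 1 + y)) -
      x * (P * g (x + y + 1) + (1 - P) * g (x + y)) with hF₁
  set F₂ : ℕ → ℕ → ℝ := fun x y =>
    P * (M - y) * g (x + (y + 1)) - (1 - P) * y * g (x + y) with hF₂
  have hsplit : ∀ x y, bcpStein P (a + M * P) a g (x + y) = F₁ x y + F₂ x y := by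
    intro x y
    rw [hF₁, hF₂, bcpStein]
    dsimp only
    rw [show x + 1 + y + 1 = x + y + 2 by omega, show x + 1 + y = x + y + 1 by omega,
      show x + (y + 1) = x + y + 1 by omega]
    push_cast
    ring
  have hF₁y : ∀ x, Integrable (fun y => F₁ x y) (binomial M P) := fun x =>
    integrable_binomial _
  have hF₂y : ∀ x, Integrable (fun y => F₂ x y) (binomial M P) := fun x =>
    integrable_binomial _
  have hF₁xy : Integrable (Function.uncurry F₁) ((poissonMeasure a).prod (binomial M P)) := by
    refine integrable_of_finite_support _
      (A := Finset.range (T + 1) ×ˢ Finset.range (T + 1)) fun z hz => ?_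
    obtain ⟨x, y⟩ := z
    have hxy : T < x ∨ T < y := by
      by_contra! h
      exact hz (Finset.mem_product.2 ⟨Finset.mem_range.2 (by omega), Finset.mem_range.2 (by omega)⟩)
    rw [Function.uncurry, hF₁]
    dsimp only
    rw [hg (x + 1 + y + 1) (by omega), hg (x + 1 + y) (by omega), hg (x + y + 1) (by omega),
      hg (x + y) (by omega)]
    ring
  have h₁ : ∫ x, ∫ y, F₁ x y ∂binomial M P ∂poissonMeasure a = 0 := by
    rw [integral_integral_swap hF₁xy]
    have : ∀ y, ∫ x, F₁ x y ∂poissonMeasure a = 0 := fun y =>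
      integral_poisson_stein a (T := T) (v := fun x => P * g (x + y + 1) + (1 - P) * g (x + y))
        fun k hk => by
          rw [hg (k + y + 1) (by omega), hg (k + y) (by omega)]
          ring
    simp [this]
  have h₂ : ∀ x, ∫ y, F₂ x y ∂binomial M P = 0 := fun x =>
    integral_binomial_stein M P fun y => g (x + y)
  have h₃ : ∀ x, ∫ y, bcpStein P (a + M * P) a g (x + y) ∂binomial M P
      = ∫ y, F₁ x y ∂binomial M P := fun x => by
    simp only [hsplit]
    rw [integral_add (hF₁y x) (hF₂y x), h₂ x, add_zero]
  simp only [h₃]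
  exact h₁

end StationaryLaw

/-! ### Total variation from a perturbed Stein equation -/

section TotalVariation

variable (ν₁ ν₂ : Measure ℕ) [IsProbabilityMeasure ν₁] [IsProbabilityMeasure ν₂]

theorem summable_real_singleton (ν : Measure ℕ) [IsProbabilityMeasure ν] :
    Summable fun k => ν.real {k} :=
  summable_of_sum_le (c := 1) (fun _ => measureReal_nonneg) fun A => by
    rw [sum_measureReal_singleton]
    exact measureReal_le_one

theorem integrable_of_abs_le (ν : Measure ℕ) [IsFiniteMeasure ν] {h : ℕ → ℝ} {B : ℝ}
    (hB : ∀ k, |h k| ≤ B) : Integrable h ν :=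
  Integrable.of_bound (measurable_of_countable h).aestronglyMeasurable B
    (Filter.Eventually.of_forall hB)

theorem summable_real_singleton_mul (ν : Measure ℕ) [IsProbabilityMeasure ν] {h : ℕ → ℝ} {B : ℝ}
    (hB : ∀ k, |h k| ≤ B) : Summable fun k => ν.real {k} * h k := by
  refine Summable.of_norm_bounded ((summable_real_singleton ν).mul_right B) fun k => ?_
  rw [norm_mul, Real.norm_of_nonneg measureReal_nonneg]
  exact mul_le_mul_of_nonneg_left (hB k) measureReal_nonneg

theorem summable_abs_sub : Summable fun k => |ν₁.real {k} - ν₂.real {k}| :=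
  ((summable_real_singleton ν₁).sub (summable_real_singleton ν₂)).abs

theorem integral_sub_integral_eq_tsum {h : ℕ → ℝ} {B : ℝ} (hB : ∀ k, |h k| ≤ B) :
    ∫ k, h k ∂ν₁ - ∫ k, h k ∂ν₂ = ∑' k, (ν₁.real {k} - ν₂.real {k}) * h k := by
  rw [integral_countable (integrable_of_abs_le ν₁ hB),
    integral_countable (integrable_of_abs_le ν₂ hB)]
  simp only [smul_eq_mul, sub_mul]
  exact ((summable_real_singleton_mul ν₁ hB).tsum_sub (summable_real_singleton_mul ν₂ hB)).symm

theorem abs_integral_sub_integral_le {h : ℕ → ℝ} {B : ℝ} (hB : ∀ k, |h k| ≤ B) :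
    |∫ k, h k ∂ν₁ - ∫ k, h k ∂ν₂| ≤ B * tvNorm ν₁ ν₂ := by
  rw [integral_sub_integral_eq_tsum ν₁ ν₂ hB, tvNorm, ← tsum_mul_left]
  rw [← Real.norm_eq_abs]
  refine tsum_of_norm_bounded ((summable_abs_sub ν₁ ν₂).mul_left B).hasSum fun k => ?_
  rw [norm_mul, Real.norm_eq_abs, Real.norm_eq_abs, mul_comm]
  exact mul_le_mul_of_nonneg_right (hB k) (abs_nonneg _)

theorem exists_integral_sub_eq_tvNorm :
    ∃ f : ℕ → ℝ, (∀ k, |f k| ≤ 1) ∧ ∫ k, f k ∂ν₁ - ∫ k, f k ∂ν₂ = tvNorm ν₁ ν₂ := by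
  refine ⟨fun k => if 0 ≤ ν₁.real {k} - ν₂.real {k} then 1 else -1, ?_, ?_⟩
  · intro k; dsimp only; split_ifs <;> simp
  · rw [integral_sub_integral_eq_tsum ν₁ ν₂ (B := 1)
      (by intro k; split_ifs <;> simp), tvNorm]
    congr 1
    funext k
    split_ifs with h
    · rw [abs_of_nonneg h, mul_one]
    · rw [abs_of_neg (not_le.1 h)]; ring

variable {ν₁ ν₂}

theorem integral_indicator_Ioi_le (ν : Measure ℕ) [IsProbabilityMeasure ν] {t : ℕ → ℝ} {T : ℕ}
    (ht : ∀ k, |t k| ≤ 2) (h0 : ∀ k ≤ T, t k = 0) : |∫ k, t k ∂ν| ≤ 2 * ν.real {k | T < k} := by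
  have h : ∀ k, ‖t k‖ ≤ 2 * Set.indicator {k | T < k} (1 : ℕ → ℝ) k := by
    intro k
    by_cases hk : T < k
    · simpa [Set.indicator, hk] using ht k
    · simp [Set.indicator, hk, h0 k (not_lt.1 hk)]
  rw [← Real.norm_eq_abs]
  refine (norm_integral_le_of_norm_le ?_ (Filter.Eventually.of_forall h)).trans (le_of_eq ?_)
  · refine integrable_of_abs_le ν (B := 2) fun k => ?_
    by_cases hk : T < k <;> simp [Set.indicator, hk]
  · rw [integral_const_mul, integral_indicator_one (Set.to_countable _).measurableSet]

/-- Total variation bound by Stein's method: the perturbation of the pseudo-binomial operator costs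
a multiple `2 θ` of the total variation norm itself, which is absorbed on the left. -/
theorem tvNorm_le_of_stein {P N a θ C : ℝ} {T : ℕ} (hP0 : 0 < P) (hP1 : P < 1) (ha : 0 ≤ a)
    (hN0 : 0 < N) (hN : (T : ℝ) ≤ N) (hθ : a ≤ θ * ((1 - P) * N))
    (h₂ : ∀ g : ℕ → ℝ, (∀ k, T < k → g k = 0) → ∫ k, bcpStein P (P * N) a g k ∂ν₂ = 0)
    (h₁ : ∀ f : ℕ → ℝ, (∀ k, |f k| ≤ 1) →
      |∫ k, bcpStein P (P * N) a (pbSol P (1 - P) N T f) k ∂ν₁| ≤ C) :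
    (1 - 2 * θ) * tvNorm ν₁ ν₂ ≤ C + 2 * ν₁.real {k | T < k} + 2 * ν₂.real {k | T < k} := by
  obtain ⟨f, hf, hfTV⟩ := exists_integral_sub_eq_tvNorm ν₁ ν₂
  have hQ : 0 < 1 - P := sub_pos.2 hP1
  set g := pbSol P (1 - P) N T f with hg
  set c := pbMean P (1 - P) N T f
  have hc : |c| ≤ 1 := abs_pbMean_le hP0 hQ hN hf
  have hgT : ∀ k, T < k → g k = 0 := fun k hk => pbSol_of_lt hk
  set u : ℕ → ℝ := fun k => a * P * (g (k + 2) - g (k + 1)) with hu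
  set t : ℕ → ℝ := fun k => if k ≤ T then 0 else f k - c with ht
  set A : ℕ → ℝ := bcpStein P (P * N) a g with hA
  have hfc : ∀ k, f k = (A k - u k) + t k + c := by
    intro k
    have hAu : A k - u k = P * (N - k) * g (k + 1) - (1 - P) * k * g k := by
      rw [hA, hu, bcpStein]; ring
    rw [hAu, ht]
    dsimp only
    split_ifs with hk
    · rw [hg, pbSol_eq hP0 hQ hN f hk]; ring
    · rw [hgT k (by omega), hgT (k + 1) (by omega)]; ring
  have hub : ∀ k, |u k| ≤ 2 * θ := by
    intro k
    have h := (abs_pbSol_diff_le hP0 hQ (by ring) hN hf k).2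
    rw [hu]
    dsimp only
    rw [abs_mul, abs_of_nonneg (mul_nonneg ha hP0.le)]
    set D := |g (k + 2) - g (k + 1)|
    have hD : 0 ≤ D := abs_nonneg _
    have hθ0 : 0 ≤ θ := nonneg_of_mul_nonneg_left (ha.trans hθ) (mul_pos hQ hN0)
    calc a * P * D ≤ θ * ((1 - P) * N) * P * D := by gcongr
      _ = θ * (D * (P * (1 - P) * N)) := by ring
      _ ≤ θ * 2 := mul_le_mul_of_nonneg_left h hθ0
      _ = 2 * θ := by ring
  have htb : ∀ k, |t k| ≤ 2 := by
    intro k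
    rw [ht]
    dsimp only
    split_ifs
    · simp
    · exact (abs_sub _ _).trans (by linarith [hf k])
  have hint : ∀ (ν : Measure ℕ) [IsProbabilityMeasure ν],
      ∫ k, f k ∂ν = ∫ k, A k ∂ν - ∫ k, u k ∂ν + ∫ k, t k ∂ν + c := by
    intro ν _
    have iA : Integrable A ν := integrable_of_finite_support ν (A := Finset.range (T + 1))
      fun k hk => by
        have hk' : T < k := by simpa using hk
        rw [hA, bcpStein, hgT k hk', hgT (k + 1) (by omega), hgT (k + 2) (by omega)]
        ring
    have iu : Integrable u ν := integrable_of_abs_le ν hub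
    have it : Integrable t ν := integrable_of_abs_le ν htb
    have e1 : ∫ k, (A k - u k) ∂ν = ∫ k, A k ∂ν - ∫ k, u k ∂ν := integral_sub iA iu
    have e2 : ∫ k, (A k - u k + t k) ∂ν = ∫ k, (A k - u k) ∂ν + ∫ k, t k ∂ν :=
      integral_add (iA.sub iu) it
    have e3 : ∫ k, (A k - u k + t k + c) ∂ν = ∫ k, (A k - u k + t k) ∂ν + ∫ _, c ∂ν :=
      integral_add ((iA.sub iu).add it) (integrable_const c)
    rw [integral_congr_ae (Filter.Eventually.of_forall hfc), e3, e2, e1]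
    simp
  have hU := abs_integral_sub_integral_le ν₁ ν₂ hub
  have ht0 : ∀ k ≤ T, t k = 0 := fun k hk => by rw [ht]; exact if_pos hk
  have ht₁ := integral_indicator_Ioi_le ν₁ htb ht0
  have ht₂ := integral_indicator_Ioi_le ν₂ htb ht0
  have hA₁ := h₁ f hf
  have hA₂ := h₂ g hgT
  rw [hint ν₁, hint ν₂, hA₂] at hfTV
  rw [abs_le] at hU ht₁ ht₂ hA₁
  linarith [hU.1, ht₁.2, ht₂.1, hA₁.2]

end TotalVariation

/-! ### The parameters of the approximating law -/

section Parameters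

variable {n : ℕ} {p : Fin n → ℝ}

theorem le_tau (p : Fin n → ℝ) (i : Fin n) : p i * (1 - p i) ≤ tau p :=
  le_ciSup (f := fun i => p i * (1 - p i)) (Set.finite_range _).bddAbove i

theorem tau_nonneg (hp : ∀ i, p i ∈ Set.Icc (0 : ℝ) 1) : 0 ≤ tau p :=
  Real.iSup_nonneg fun i => mul_nonneg (hp i).1 (sub_nonneg.2 (hp i).2)

theorem exists_mem_Ioo_of_sigmaSq_pos (hp : ∀ i, p i ∈ Set.Icc (0 : ℝ) 1) (h : 0 < sigmaSq p) :
    ∃ i, p i ∈ Set.Ioo (0 : ℝ) 1 := by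
  obtain ⟨i, -, hi⟩ := Finset.exists_lt_of_sum_lt (s := Finset.univ) (f := fun _ : Fin n => (0 : ℝ))
    (g := fun i => p i * (1 - p i)) (by simpa [sigmaSq] using h)
  exact ⟨i, pos_of_mul_pos_left hi (sub_nonneg.2 (hp i).2),
    sub_pos.1 (pos_of_mul_pos_right hi (hp i).1)⟩

theorem powerSum_pos (hp : ∀ i, p i ∈ Set.Icc (0 : ℝ) 1) (h : ∃ i, p i ∈ Set.Ioo (0 : ℝ) 1)
    (k : ℕ) : 0 < powerSum p k := by
  obtain ⟨i, hi⟩ := h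
  exact Finset.sum_pos' (fun j _ => pow_nonneg (hp j).1 k) ⟨i, Finset.mem_univ i, pow_pos hi.1 k⟩

theorem prob_mem_Ioo (hp : ∀ i, p i ∈ Set.Icc (0 : ℝ) 1) (h : ∃ i, p i ∈ Set.Ioo (0 : ℝ) 1) :
    prob p ∈ Set.Ioo (0 : ℝ) 1 := by
  have h2 := powerSum_pos hp h 2
  refine ⟨mul_pos (powerSum_pos hp h 3) (inv_pos.2 h2), ?_⟩
  rw [prob, ← div_eq_mul_inv, div_lt_one h2]
  obtain ⟨i, hi⟩ := h
  exact Finset.sum_lt_sum (fun j _ => pow_le_pow_of_le_one (hp j).1 (hp j).2 (by norm_num))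
    ⟨i, Finset.mem_univ i, pow_lt_pow_right_of_lt_one₀ hi.1 hi.2 (by norm_num)⟩

theorem prob_mul_powerSum_two (h2 : 0 < powerSum p 2) : prob p * powerSum p 2 = powerSum p 3 := by
  rw [prob, inv_mul_cancel_right₀ h2.ne']

theorem prob_le_sum (hp : ∀ i, p i ∈ Set.Icc (0 : ℝ) 1) (h2 : 0 < powerSum p 2) :
    prob p ≤ ∑ i, p i := by
  refine le_of_mul_le_mul_right ?_ h2
  rw [prob_mul_powerSum_two h2, powerSum, powerSum, Finset.sum_mul]
  refine Finset.sum_le_sum fun i _ => ?_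
  have : p i ^ 2 ≤ ∑ j, p j ^ 2 :=
    Finset.single_le_sum (fun j _ => sq_nonneg (p j)) (Finset.mem_univ i)
  nlinarith [mul_le_mul_of_nonneg_left this (hp i).1]

theorem delta_nonneg (h2 : 0 < powerSum p 2) (h3 : 0 < powerSum p 3) : 0 ≤ delta p :=
  sub_nonneg.2 (Nat.floor_le (by rw [trialsReal]; positivity))

/-- The number of trials matches the variances up to the rounding error `δ`. -/
theorem delta_mul_prob_sq (h2 : 0 < powerSum p 2) (h3 : 0 < powerSum p 3) :
    delta p * prob p ^ 2 = powerSum p 2 - trials p * prob p ^ 2 := by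
  have : trialsReal p * prob p ^ 2 = powerSum p 2 := by
    rw [trialsReal, prob]; field_simp
  rw [delta, sub_mul, this]

theorem prob_mul_powerSum_three_le (hp : ∀ i, p i ∈ Set.Icc (0 : ℝ) 1) (h2 : 0 < powerSum p 2) :
    prob p * powerSum p 3 ≤ powerSum p 4 := by
  have hcs : powerSum p 3 ^ 2 ≤ powerSum p 2 * powerSum p 4 :=
    Finset.sum_sq_le_sum_mul_sum_of_sq_le_mul _ (fun i _ => pow_nonneg (hp i).1 2)
      (fun i _ => pow_nonneg (hp i).1 4) (fun i _ => le_of_eq (by ring))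
  refine le_of_mul_le_mul_right ?_ h2
  calc prob p * powerSum p 3 * powerSum p 2 = (prob p * powerSum p 2) * powerSum p 3 := by ring
    _ = powerSum p 3 ^ 2 := by rw [prob_mul_powerSum_two h2, sq]
    _ ≤ powerSum p 4 * powerSum p 2 := by rw [mul_comm (powerSum p 4)]; exact hcs

end Parameters

end BCPApprox

open BCPApprox in
theorem corollary4p5 {Ω : Type*} [MeasurableSpace Ω] (μ : Measure Ω) [IsProbabilityMeasure μ]
    (n : ℕ) (X : Fin n → Ω → ℕ) (hX : ∀ i, Measurable (X i))
    (hX01 : ∀ i ω, X i ω = 0 ∨ X i ω = 1) (hind : iIndepFun X μ)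
    (p : Fin n → ℝ) (hp : ∀ i, p i = μ.real {ω | X i ω = 1})
    (hθ : BCPApprox.theta2 p < 1 / 2)
    (hσ : 3 * BCPApprox.tau p < BCPApprox.sigmaSq p) :
    BCPApprox.tvNorm (μ.map (fun ω => ∑ i, X i ω)) (BCPApprox.bcp p) ≤
      2 / (1 - 2 * BCPApprox.theta2 p) *
        (4 / (BCPApprox.prob p * (1 - BCPApprox.prob p) * (BCPApprox.That p : ℝ) *
              (BCPApprox.sigmaSq p - 3 * BCPApprox.tau p)) *
            ((∑ i, p i ^ 4) - BCPApprox.prob p * ∑ i, p i ^ 3)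
          + BCPApprox.delta p * BCPApprox.prob p ^ 2
          + μ.real {ω | BCPApprox.That p < ∑ i, X i ω}
          + (BCPApprox.bcp p).real {k | BCPApprox.That p < k}) := by
  have hp01 : ∀ i, p i ∈ Set.Icc (0 : ℝ) 1 := fun i => by
    rw [hp i]; exact ⟨measureReal_nonneg, measureReal_le_one⟩
  have hτ := tau_nonneg hp01
  have hex := exists_mem_Ioo_of_sigmaSq_pos hp01 (by linarith)
  have h2 := powerSum_pos hp01 hex 2
  have h3 := powerSum_pos hp01 hex 3
  obtain ⟨hP0, hP1⟩ := prob_mem_Ioo hp01 hex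
  have ha := alpha_nonneg hp01
  have hPS := prob_mul_powerSum_two h2
  have hδ := delta_nonneg h2 h3
  have hδP := delta_mul_prob_sq h2 h3
  have h43 := prob_mul_powerSum_three_le hp01 h2
  have hPle := prob_le_sum hp01 h2
  have hQ : 0 < 1 - prob p := sub_pos.2 hP1
  have hmean : alpha p + trials p * prob p = ∑ i, p i := sub_add_cancel _ _
  -- The pseudo-binomial law has `N` trials, so that its mean `prob p * N` is the mean of `W`.
  set N : ℝ := (trials p : ℝ) + alpha p / prob p with hNdef
  have hPN : prob p * N = ∑ i, p i := by
    rw [hNdef, mul_add, mul_div_cancel₀ _ hP0.ne', ← hmean]; ring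
  have hN1 : 1 ≤ N := by
    refine le_of_mul_le_mul_left ?_ hP0
    rw [mul_one, hPN]; exact hPle
  have hTN : (That p : ℝ) ≤ N := Nat.floor_le (by linarith)
  have hT1 : (1 : ℝ) ≤ That p := by
    exact_mod_cast Nat.le_floor (show ((1 : ℕ) : ℝ) ≤ N by simpa using hN1)
  have hV : 0 < sigmaSq p - 3 * tau p := sub_pos.2 hσ
  have hWm : Measurable fun ω => ∑ i, X i ω := Finset.measurable_sum _ fun i _ => hX i
  have : IsProbabilityMeasure (μ.map fun ω => ∑ i, X i ω) :=
    Measure.isProbabilityMeasure_map hWm.aemeasurable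
  have : IsProbabilityMeasure (bcp p) := by rw [bcp]; infer_instance
  have hθN : alpha p ≤ theta2 p * ((1 - prob p) * N) := by
    have hpos : 0 < (1 - prob p) * (That p : ℝ) := mul_pos hQ (by linarith)
    have h0 : 0 ≤ theta2 p := div_nonneg ha hpos.le
    calc alpha p = theta2 p * ((1 - prob p) * That p) := (div_mul_cancel₀ _ hpos.ne').symm
      _ ≤ theta2 p * ((1 - prob p) * N) := by gcongr
  have hbcp : ∀ g : ℕ → ℝ, (∀ k, That p < k → g k = 0) →
      ∫ k, bcpStein (prob p) (prob p * N) (alpha p) g k ∂bcp p = 0 := by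
    intro g hg
    have h := integral_bcpStein_conv (alpha p).toNNReal (trials p)
      (Set.projIcc (0 : ℝ) 1 zero_le_one (prob p)) hg
    rw [Real.coe_toNNReal _ ha, Set.projIcc_of_mem zero_le_one (prob_mem_Icc hp01)] at h
    rw [hPN, ← hmean, bcp, Set.projIcc_of_mem zero_le_one (prob_mem_Icc hp01)]
    exact h
  set C : ℝ := delta p * prob p ^ 2 * 2 + ((∑ i, p i ^ 4) - prob p * ∑ i, p i ^ 3) *
    (4 / (sigmaSq p - 3 * tau p) * (2 / (prob p * (1 - prob p) * N))) with hC
  have hW : ∀ f : ℕ → ℝ, (∀ k, |f k| ≤ 1) →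
      |∫ k, bcpStein (prob p) (prob p * N) (alpha p) (pbSol (prob p) (1 - prob p) N (That p) f) k
        ∂(μ.map fun ω => ∑ i, X i ω)| ≤ C := by
    intro f hf
    have hinc := abs_pbSol_diff_le hP0 hQ (by ring) hTN hf
    set g := pbSol (prob p) (1 - prob p) N (That p) f
    rw [integral_map hWm.aemeasurable (measurable_of_countable _).aestronglyMeasurable,
      integral_sum_indicators μ hX hX01 hind hp Finset.univ, hPN]
    -- The variance mismatch is paired with the absolute bound on the increments, the pair term with
    -- the bound of order `1 / (p q N)`.
    have hmain := abs_bernExp_bcpStein_le (p := p) (P := prob p) (a := alpha p) (g := g)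
      (K := 4 / (sigmaSq p - 3 * tau p) * (2 / (prob p * (1 - prob p) * N))) h2 hPS
      (abs_bernExp_le hp01 Finset.univ fun k => (hinc k).1) fun i j hij => by
        refine abs_bernExp_diff_diff_le hp01 hτ (le_tau p) _ hV ?_
          (h := fun k => g (k + 2) - g (k + 1)) fun k => ?_
        · have e1 := Finset.add_sum_erase Finset.univ (fun i => p i * (1 - p i))
            (Finset.mem_univ i)
          have e2 := Finset.add_sum_erase (Finset.univ.erase i) (fun i => p i * (1 - p i))
            (Finset.mem_erase.2 ⟨hij.symm, Finset.mem_univ j⟩)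
          have e3 : sigmaSq p = ∑ i, p i * (1 - p i) := rfl
          have := le_tau p i
          have := le_tau p j
          linarith
        · rw [le_div_iff₀ (mul_pos (mul_pos hP0 hQ) (by linarith))]
          exact (hinc k).2
    have hcoef : ∑ i, p i ^ 2 - prob p * ∑ i, p i + alpha p * prob p = delta p * prob p ^ 2 := by
      rw [hδP, powerSum, ← hmean]; ring
    rwa [hcoef, abs_of_nonneg (mul_nonneg hδ (sq_nonneg _))] at hmain
  have htv := tvNorm_le_of_stein hP0 hP1 ha (by linarith) hTN hθN hbcp hW
  have hCle : C ≤ 2 * (4 / (prob p * (1 - prob p) * (That p : ℝ) * (sigmaSq p - 3 * tau p)) *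
      ((∑ i, p i ^ 4) - prob p * ∑ i, p i ^ 3) + delta p * prob p ^ 2) := by
    have hvar : 0 ≤ (∑ i, p i ^ 4) - prob p * ∑ i, p i ^ 3 := sub_nonneg.2 h43
    have hle : 2 / (prob p * (1 - prob p) * N) ≤ 2 / (prob p * (1 - prob p) * That p) := by
      have : 0 < prob p * (1 - prob p) * (That p : ℝ) :=
        mul_pos (mul_pos hP0 hQ) (by linarith)
      gcongr
    have h := mul_le_mul_of_nonneg_left (mul_le_mul_of_nonneg_left hle
      (div_nonneg zero_le_four hV.le)) hvar
    have e : ((∑ i, p i ^ 4) - prob p * ∑ i, p i ^ 3) *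
        (4 / (sigmaSq p - 3 * tau p) * (2 / (prob p * (1 - prob p) * That p)))
        = 2 * (4 / (prob p * (1 - prob p) * (That p : ℝ) * (sigmaSq p - 3 * tau p)) *
          ((∑ i, p i ^ 4) - prob p * ∑ i, p i ^ 3)) := by
      rw [div_mul_div_comm]
      ring
    rw [hC]
    linarith
  have htail : (μ.map fun ω => ∑ i, X i ω).real {k | That p < k}
      = μ.real {ω | That p < ∑ i, X i ω} :=
    map_measureReal_apply hWm (Set.to_countable _).measurableSet
  have hθ' : 0 < 1 - 2 * theta2 p := by linarith
  rw [div_mul_eq_mul_div, le_div_iff₀ hθ', mul_comm]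
  rw [htail] at htv
  linarith
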